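/- Let $\mathbb H$ be the quaternions, $\mathbb B=\{q\in\mathbb H:|q|<1\}$, $\mathrm{Sp}(1)=\{u\in\mathbb H:|u|=1\}$, and $\mathrm{Sp}(1,1)=\{A\in M_2(\mathbb H): A^*I_{1,1}A=I_{1,1}\}$ with $I_{1,1}=\mathrm{diag}(1,-1)$, a Lie group that is an embedded submanifold of $M_2(\mathbb H)\cong\mathbb R^{16}$; put $\mathrm{Sp}(1)I_2=\{uI_2:u\in\mathrm{Sp}(1)\}$. The quotient $\mathrm{Sp}(1,1)/\mathrm{Sp}(1)I_2$ (left cosets $A\,\mathrm{Sp}(1)I_2$) carries the quotient topology and the smooth structure for which the projection from $\mathrm{Sp}(1,1)$ is a submersion. For functions $f(q)=\sum_n q^na_n$ and $g(q)=\sum_n q^nb_n$ given by power series converging on $\mathbb B$ (the slice regular functions on $\mathbb B$) let $(f*g)(q)=\sum_n q^n\sum_{k=0}^n a_kb_{n-k}$, $f^c(q)=\sum_n q^n\overline{a_n}$, $f^s=f*f^c$, and, if $f^s$ has no zero in $\mathbb B$, $f^{-*}(q)=f^s(q)^{-1}f^c(q)$. For $A=\begin{pmatrix}a&c\\ b&d\end{pmatrix}\in\mathrm{Sp}(1,1)$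 the regular Möbius transformation of $\mathbb B$ associated to $A$ is $\mathcal F_A(q)=(qc+d)^{-*}*(qa+b)$, and $\mathcal M(\mathbb B)=\{\mathcal F_A:A\in\mathrm{Sp}(1,1)\}$. Theorem. The projection $\mathrm{Sp}(1,1)\to\mathrm{Sp}(1,1)/\mathrm{Sp}(1)I_2$ is a smooth submersion, and $\mathcal M(\mathbb B)$ has a smooth manifold structure for which $A\,\mathrm{Sp}(1)I_2\mapsto\mathcal F_{A^{-1}}$ is a well-defined diffeomorphism from $\mathrm{Sp}(1,1)/\mathrm{Sp}(1)I_2$ onto $\mathcal M(\mathbb B)$. For this structure, the map $$\varphi:\mathbb B\times\mathrm{Sp}(1)\to\mathcal M(\mathbb B),\qquad \varphi(a,u)(q)=(1-q\bar a)^{-*}*(q-a)u,$$ is well defined and a diffeomorphism onto $\mathcal M(\mathbb B)$. In particular $\mathcal M(\mathbb B)$ is diffeomorphic to $\mathbb R^4\times S^3$, where $S^3$ is the unit sphere of $\mathbb R^4$. -/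

import Mathlib

open Set
open scoped Manifold ContDiff Matrix Quaternion Topology

attribute [local instance] Matrix.normedAddCommGroup Matrix.normedSpace
noncomputable section

section Submanifold

variable {E H : Type*} [NormedAddCommGroup E] [NormedSpace ℝ E]
  [NormedAddCommGroup H] [NormedSpace ℝ H]

/-- The smooth charts of an embedded submanifold `S` of `E`: local homeomorphisms from `S` to `H`
whose inverses are smooth as maps into `E` and which locally extend to smooth maps on open subsets
of `E`. -/
def submanifoldAtlas (S : Set E) (H : Type*) [NormedAddCommGroup H] [NormedSpace ℝ H] :
    Set (OpenPartialHomeomorph S H) :=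
  {e | ContDiffOn ℝ ∞ (fun y => (e.symm y : E)) e.target ∧
    ∀ x ∈ e.source, ∃ (U : Set E) (f : E → H), IsOpen U ∧ (x : E) ∈ U ∧ ContDiffOn ℝ ∞ f U ∧
      ∀ y ∈ e.source, (y : E) ∈ U → e y = f y}

/-- A subset of `E` covered by domains of charts in `submanifoldAtlas`, as a manifold. -/
@[reducible]
def submanifoldChartedSpace (S : Set E)
    (h : ∀ x : S, ∃ e ∈ submanifoldAtlas S H, x ∈ e.source) : ChartedSpace H S where
  atlas := submanifoldAtlas S H
  chartAt x := (h x).choose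
  mem_chart_source x := (h x).choose_spec.2
  chart_mem_atlas x := (h x).choose_spec.1

theorem submanifold_isManifold (S : Set E)
    (h : ∀ x : S, ∃ e ∈ submanifoldAtlas S H, x ∈ e.source) :
    letI := submanifoldChartedSpace S h
    IsManifold 𝓘(ℝ, H) ∞ S := by
  let _ := submanifoldChartedSpace S h
  refine isManifold_of_contDiffOn _ _ _ ?_
  intro e e' he he' x hx
  simp only [modelWithCornersSelf_coe_symm, preimage_id_eq, id_eq, modelWithCornersSelf_coe, range_id,
    inter_univ, OpenPartialHomeomorph.trans_source, OpenPartialHomeomorph.symm_source, mem_inter_iff,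
    mem_preimage] at hx
  obtain ⟨U, f, hU, hxU, hf, hef⟩ := he'.2 _ hx.2
  have h1 : ContDiffAt ℝ ∞ (fun y => (e.symm y : E)) x :=
    (he.1 x hx.1).contDiffAt (e.open_target.mem_nhds hx.1)
  have h2 : ContDiffAt ℝ ∞ (fun y => f (e.symm y : E)) x :=
    ContDiffAt.comp x ((hf _ hxU).contDiffAt (hU.mem_nhds hxU)) h1
  refine (h2.congr_of_eventuallyEq ?_).contDiffWithinAt
  have c1 : ∀ᶠ y in 𝓝 x, e.symm y ∈ e'.source :=
    (e.continuousAt_symm hx.1).eventually (e'.open_source.mem_nhds hx.2)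
  have c2 : ∀ᶠ y in 𝓝 x, (e.symm y : E) ∈ U :=
    h1.continuousAt.eventually (hU.mem_nhds hxU)
  filter_upwards [c1, c2] with y hy1 hy2
  exact hef _ hy1 hy2

/-- The inclusion of a submanifold is smooth. -/
theorem submanifold_contMDiff_coe (S : Set E)
    (h : ∀ x : S, ∃ e ∈ submanifoldAtlas S H, x ∈ e.source) :
    letI := submanifoldChartedSpace S h
    ContMDiff 𝓘(ℝ, H) 𝓘(ℝ, E) ∞ ((↑) : S → E) := by
  let _ := submanifoldChartedSpace S h
  have := submanifold_isManifold S h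
  intro x
  have hc := (h x).choose_spec
  have hm : chartAt H x ∈ IsManifold.maximalAtlas 𝓘(ℝ, H) ∞ S := IsManifold.chart_mem_maximalAtlas x
  have hx : x ∈ (chartAt H x).source := mem_chart_source H x
  have h1 : ContMDiffAt 𝓘(ℝ, H) 𝓘(ℝ, E) ∞ (fun y => ((chartAt H x).symm y : E)) (chartAt H x x) :=
    ((hc.1.1 _ ((chartAt H x).map_source hx)).contDiffAt
      ((chartAt H x).open_target.mem_nhds ((chartAt H x).map_source hx))).contMDiffAt
  refine (ContMDiffAt.comp x h1 (contMDiffAt_of_mem_maximalAtlas hm hx)).congr_of_eventuallyEq ?_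
  filter_upwards [(chartAt H x).open_source.mem_nhds hx] with y hy
  simp [(chartAt H x).left_inv hy]

/-- The restriction to a submanifold of a smooth map is smooth. -/
theorem submanifold_contMDiffOn_restrict (S : Set E)
    (h : ∀ x : S, ∃ e ∈ submanifoldAtlas S H, x ∈ e.source)
    {F : Type*} [NormedAddCommGroup F] [NormedSpace ℝ F] {U : Set E} {f : E → F}
    (hf : ContDiffOn ℝ ∞ f U) :
    letI := submanifoldChartedSpace S h
    ContMDiffOn 𝓘(ℝ, H) 𝓘(ℝ, F) ∞ (fun x : S => f x) {x : S | (x : E) ∈ U} := by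
  let _ := submanifoldChartedSpace S h
  exact hf.contMDiffOn.comp (submanifold_contMDiff_coe S h).contMDiffOn fun _ hx => hx

/-- A map into a submanifold is smooth if it is smooth as a map into `E`. -/
theorem submanifold_contMDiffOn_of_coe (S : Set E)
    (h : ∀ x : S, ∃ e ∈ submanifoldAtlas S H, x ∈ e.source)
    {F : Type*} [NormedAddCommGroup F] [NormedSpace ℝ F] {U : Set F} (hU : IsOpen U)
    {σ : F → S} (hσ : ContDiffOn ℝ ∞ (fun x => (σ x : E)) U) :
    letI := submanifoldChartedSpace S h
    ContMDiffOn 𝓘(ℝ, F) 𝓘(ℝ, H) ∞ σ U := by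
  let _ := submanifoldChartedSpace S h
  have := submanifold_isManifold S h
  intro x hx
  refine ContMDiffAt.contMDiffWithinAt ?_
  have h1 : ContDiffAt ℝ ∞ (fun x => (σ x : E)) x := (hσ x hx).contDiffAt (hU.mem_nhds hx)
  have hcont : ContinuousAt σ x :=
    (Topology.IsInducing.subtypeVal.continuousAt_iff).2 h1.continuousAt
  set e := chartAt H (σ x) with he
  have hm : e ∈ IsManifold.maximalAtlas 𝓘(ℝ, H) ∞ S := IsManifold.chart_mem_maximalAtlas _
  have hx' : σ x ∈ e.source := mem_chart_source H _
  obtain ⟨V, f, hV, hxV, hf, hef⟩ := (h (σ x)).choose_spec.1.2 (σ x) hx'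
  have h2 : ContDiffAt ℝ ∞ (fun y => f (σ y : E)) x :=
    ContDiffAt.comp x ((hf _ hxV).contDiffAt (hV.mem_nhds hxV)) h1
  have c1 : ∀ᶠ y in 𝓝 x, σ y ∈ e.source := hcont.eventually (e.open_source.mem_nhds hx')
  have c2 : ∀ᶠ y in 𝓝 x, (σ y : E) ∈ V := h1.continuousAt.eventually (hV.mem_nhds hxV)
  have h3 : ContMDiffAt 𝓘(ℝ, F) 𝓘(ℝ, H) ∞ (fun y => e (σ y)) x := by
    refine h2.contMDiffAt.congr_of_eventuallyEq ?_
    filter_upwards [c1, c2] with y hy1 hy2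
    exact hef _ hy1 hy2
  have h4 := contMDiffAt_symm_of_mem_maximalAtlas hm (e.map_source hx')
  refine (ContMDiffAt.comp x h4 h3).congr_of_eventuallyEq ?_
  filter_upwards [c1] with y hy1
  simp [e.left_inv hy1]

end Submanifold

section Quotient

variable {P X F H : Type*} [NormedAddCommGroup F] [NormedSpace ℝ F]
  [NormedAddCommGroup H] [NormedSpace ℝ H]
  [TopologicalSpace P] [ChartedSpace F P] [TopologicalSpace X]

/-- The smooth charts of the base of a submersion `π : P → X`: local homeomorphisms `e` from `X`
to `H` such that `e ∘ π` is smooth and such that `e⁻¹` lifts locally along `π` to smooth maps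
into `P`. -/
def quotientAtlas (F H : Type*) [NormedAddCommGroup F] [NormedSpace ℝ F]
    [NormedAddCommGroup H] [NormedSpace ℝ H] [ChartedSpace F P] (π : P → X) :
    Set (OpenPartialHomeomorph X H) :=
  {e | ContMDiffOn 𝓘(ℝ, F) 𝓘(ℝ, H) ∞ (e ∘ π) (π ⁻¹' e.source) ∧
    ∀ y ∈ e.target, ∃ (U : Set H) (σ : H → P), IsOpen U ∧ y ∈ U ∧ U ⊆ e.target ∧
      ContMDiffOn 𝓘(ℝ, H) 𝓘(ℝ, F) ∞ σ U ∧ ∀ z ∈ U, π (σ z) = e.symm z}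

/-- A space covered by domains of charts in `quotientAtlas`, as a manifold. -/
@[reducible]
def quotientChartedSpace (π : P → X)
    (h : ∀ x : X, ∃ e ∈ quotientAtlas F H π, x ∈ e.source) : ChartedSpace H X where
  atlas := quotientAtlas F H π
  chartAt x := (h x).choose
  mem_chart_source x := (h x).choose_spec.2
  chart_mem_atlas x := (h x).choose_spec.1

theorem quotient_isManifold (π : P → X) (hπ : Continuous π)
    (h : ∀ x : X, ∃ e ∈ quotientAtlas F H π, x ∈ e.source) :
    letI := quotientChartedSpace π h
    IsManifold 𝓘(ℝ, H) ∞ X := by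
  let _ := quotientChartedSpace π h
  refine isManifold_of_contDiffOn _ _ _ ?_
  intro e e' he he' x hx
  simp only [modelWithCornersSelf_coe_symm, preimage_id_eq, id_eq, modelWithCornersSelf_coe, range_id,
    inter_univ, OpenPartialHomeomorph.trans_source, OpenPartialHomeomorph.symm_source, mem_inter_iff,
    mem_preimage] at hx
  obtain ⟨U, σ, hU, hxU, -, hσ, hσe⟩ := he.2 x hx.1
  have hs : σ x ∈ π ⁻¹' e'.source := by
    rw [mem_preimage, hσe x hxU]; exact hx.2
  have h1 : ContMDiffAt 𝓘(ℝ, H) 𝓘(ℝ, F) ∞ σ x := (hσ x hxU).contMDiffAt (hU.mem_nhds hxU)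
  have h2 : ContMDiffAt 𝓘(ℝ, F) 𝓘(ℝ, H) ∞ (e' ∘ π) (σ x) :=
    (he'.1 _ hs).contMDiffAt ((e'.open_source.preimage hπ).mem_nhds hs)
  have h3 : ContDiffAt ℝ ∞ ((e' ∘ π) ∘ σ) x := contMDiffAt_iff_contDiffAt.1 (h2.comp x h1)
  refine (h3.congr_of_eventuallyEq ?_).contDiffWithinAt
  filter_upwards [hU.mem_nhds hxU] with y hy
  simp [hσe y hy]

end Quotient

/-! ### The group `Sp(1,1)` -/

/-- The matrix `I_{1,1} = diag(1, -1)`. -/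
def signatureMatrix : Matrix (Fin 2) (Fin 2) ℍ[ℝ] := !![1, 0; 0, -1]

/-- `Sp(1,1)`, as a subset of the space of `2 × 2` quaternionic matrices. -/
def SpOneOne : Set (Matrix (Fin 2) (Fin 2) ℍ[ℝ]) :=
  {A | Aᴴ * signatureMatrix * A = signatureMatrix}

theorem signatureMatrix_mul_self : signatureMatrix * signatureMatrix = 1 := by
  ext1 i j
  fin_cases i <;> fin_cases j <;> simp [signatureMatrix, Matrix.mul_apply, Fin.sum_univ_two]

theorem signatureMatrix_conjTranspose : signatureMatrixᴴ = signatureMatrix := by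
  ext1 i j
  fin_cases i <;> fin_cases j <;> simp [signatureMatrix]

theorem SpOneOne.inv_mul {A : Matrix (Fin 2) (Fin 2) ℍ[ℝ]} (hA : A ∈ SpOneOne) :
    (signatureMatrix * Aᴴ * signatureMatrix) * A = 1 := by
  have h : Aᴴ * signatureMatrix * A = signatureMatrix := hA
  calc signatureMatrix * Aᴴ * signatureMatrix * A
      = signatureMatrix * (Aᴴ * signatureMatrix * A) := by simp only [mul_assoc]
    _ = 1 := by rw [h, signatureMatrix_mul_self]

theorem SpOneOne.mul_inv {A : Matrix (Fin 2) (Fin 2) ℍ[ℝ]} (hA : A ∈ SpOneOne) :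
    A * (signatureMatrix * Aᴴ * signatureMatrix) = 1 :=
  mul_eq_one_comm.mp (SpOneOne.inv_mul hA)

theorem SpOneOne.mul_mem {A B : Matrix (Fin 2) (Fin 2) ℍ[ℝ]} (hA : A ∈ SpOneOne)
    (hB : B ∈ SpOneOne) : A * B ∈ SpOneOne := by
  have hA : Aᴴ * signatureMatrix * A = signatureMatrix := hA
  have hB : Bᴴ * signatureMatrix * B = signatureMatrix := hB
  change (A * B)ᴴ * signatureMatrix * (A * B) = signatureMatrix
  calc _ = Bᴴ * (Aᴴ * signatureMatrix * A) * B := by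
        rw [Matrix.conjTranspose_mul]; simp only [mul_assoc]
    _ = _ := by rw [hA, hB]

theorem SpOneOne.one_mem : (1 : Matrix (Fin 2) (Fin 2) ℍ[ℝ]) ∈ SpOneOne := by
  change (1 : Matrix (Fin 2) (Fin 2) ℍ[ℝ])ᴴ * signatureMatrix * 1 = signatureMatrix
  simp

theorem SpOneOne.conj_mul {A : Matrix (Fin 2) (Fin 2) ℍ[ℝ]} (hA : A ∈ SpOneOne) :
    A * signatureMatrix * Aᴴ = signatureMatrix := by
  have h := SpOneOne.mul_inv hA
  calc A * signatureMatrix * Aᴴ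
      = A * (signatureMatrix * Aᴴ * signatureMatrix) * signatureMatrix := by
        simp only [mul_assoc, signatureMatrix_mul_self, mul_one]
    _ = _ := by rw [h, one_mul]

theorem SpOneOne.inv_mem {A : Matrix (Fin 2) (Fin 2) ℍ[ℝ]} (hA : A ∈ SpOneOne) :
    signatureMatrix * Aᴴ * signatureMatrix ∈ SpOneOne := by
  change (signatureMatrix * Aᴴ * signatureMatrix)ᴴ * signatureMatrix *
    (signatureMatrix * Aᴴ * signatureMatrix) = signatureMatrix
  simp only [Matrix.conjTranspose_mul, signatureMatrix_conjTranspose,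
    Matrix.conjTranspose_conjTranspose]
  calc signatureMatrix * (A * signatureMatrix) * signatureMatrix *
        (signatureMatrix * Aᴴ * signatureMatrix)
      = signatureMatrix * (A * signatureMatrix *
          (signatureMatrix * signatureMatrix) * Aᴴ) * signatureMatrix := by
        simp only [mul_assoc]
    _ = signatureMatrix := by
        rw [signatureMatrix_mul_self, mul_one, SpOneOne.conj_mul hA, signatureMatrix_mul_self,
          one_mul]

instance : Group SpOneOne where
  mul A B := ⟨A.1 * B.1, SpOneOne.mul_mem A.2 B.2⟩
  one := ⟨1, SpOneOne.one_mem⟩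
  inv A := ⟨signatureMatrix * A.1ᴴ * signatureMatrix, SpOneOne.inv_mem A.2⟩
  mul_assoc A B C := Subtype.ext (mul_assoc A.1 B.1 C.1)
  one_mul A := Subtype.ext (one_mul A.1)
  mul_one A := Subtype.ext (mul_one A.1)
  inv_mul_cancel A := Subtype.ext (SpOneOne.inv_mul A.2)

theorem SpOneOne.coe_mul (A B : SpOneOne) :
    ((A * B : SpOneOne) : Matrix (Fin 2) (Fin 2) ℍ[ℝ]) = A.1 * B.1 := rfl

theorem SpOneOne.coe_one : ((1 : SpOneOne) : Matrix (Fin 2) (Fin 2) ℍ[ℝ]) = 1 := rfl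

instance : ContinuousMul SpOneOne where
  continuous_mul := by
    refine Continuous.subtype_mk ?_ _
    exact (continuous_subtype_val.comp continuous_fst).mul
      (continuous_subtype_val.comp continuous_snd)

/-- The subgroup `Sp(1) I₂` of `Sp(1,1)`. -/
def spOneScalar : Subgroup SpOneOne where
  carrier := {A | ∃ u : ℍ[ℝ], ‖u‖ = 1 ∧ A.1 = Matrix.diagonal fun _ => u}
  mul_mem' := by
    rintro A B ⟨u, hu, hA⟩ ⟨v, hv, hB⟩
    exact ⟨u * v, by rw [norm_mul, hu, hv, one_mul], by rw [SpOneOne.coe_mul, hA, hB]; simp⟩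
  one_mem' := ⟨1, norm_one, by rw [SpOneOne.coe_one]; simp⟩
  inv_mem' := by
    rintro A ⟨u, hu, hA⟩
    refine ⟨star u, by rw [norm_star, hu], ?_⟩
    change signatureMatrix * A.1ᴴ * signatureMatrix = _
    rw [hA]
    rw [Matrix.diagonal_conjTranspose, mul_assoc]
    ext1 i j
    fin_cases i <;> fin_cases j <;>
      simp [signatureMatrix, Matrix.vecMul, dotProduct, Matrix.diagonal_mul, Fin.sum_univ_two]

/-! ### Charts of `Sp(1,1)` and of `Sp(1,1) / Sp(1) I₂` -/

theorem SpOneOne.rel {A : Matrix (Fin 2) (Fin 2) ℍ[ℝ]} (hA : A ∈ SpOneOne) :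
    Quaternion.normSq (A 1 1) = 1 + Quaternion.normSq (A 0 1) ∧
    Quaternion.normSq (A 0 0) = 1 + Quaternion.normSq (A 0 1) ∧
    star (A 1 1) * A 1 0 = star (A 0 1) * A 0 0 := by
  have h : Aᴴ * signatureMatrix * A = signatureMatrix := hA
  have h' := SpOneOne.conj_mul hA
  have h11 := congr_fun (congr_fun h 1) 1
  have h10 := congr_fun (congr_fun h 1) 0
  have h00 := congr_fun (congr_fun h' 0) 0
  simp [signatureMatrix, Matrix.mul_apply, Fin.sum_univ_two, Quaternion.star_mul_self,
    Quaternion.self_mul_star] at h11 h10 h00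
  refine ⟨?_, ?_, ?_⟩
  · have := congrArg QuaternionAlgebra.re h11
    simp at this
    linarith
  · have := congrArg QuaternionAlgebra.re h00
    simp at this
    linarith
  · rw [add_neg_eq_zero] at h10
    exact h10.symm

theorem SpOneOne.ext' {A B : SpOneOne} (h0 : A.1 0 0 = B.1 0 0) (h1 : A.1 0 1 = B.1 0 1)
    (h2 : A.1 1 1 = B.1 1 1) : A = B := by
  obtain ⟨a1, -, a3⟩ := SpOneOne.rel A.2
  obtain ⟨-, -, b3⟩ := SpOneOne.rel B.2
  have hne : star (A.1 1 1) ≠ 0 := by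
    intro h0
    have : A.1 1 1 = 0 := by simpa using h0
    rw [this] at a1
    have := Quaternion.normSq_nonneg (a := A.1 0 1)
    simp at a1
    linarith
  have h3 : A.1 1 0 = B.1 1 0 := by
    apply mul_left_cancel₀ hne
    rw [a3, h2, b3, h0, h1]
  apply Subtype.ext
  ext1 i j
  fin_cases i <;> fin_cases j <;> assumption

/-- The quantity `√(1 + |c|²)`. -/
def rad (c : ℍ[ℝ]) : ℝ := √(1 + Quaternion.normSq c)

theorem rad_pos (c : ℍ[ℝ]) : 0 < rad c := by
  have := Quaternion.normSq_nonneg (a := c)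
  exact Real.sqrt_pos.2 (by linarith)

theorem rad_sq (c : ℍ[ℝ]) : rad c * rad c = 1 + Quaternion.normSq c := by
  have := Quaternion.normSq_nonneg (a := c)
  exact Real.mul_self_sqrt (by linarith)

/-- Inverse stereographic projection onto the unit quaternions. -/
def invStereo (r s t : ℝ) : ℍ[ℝ] :=
  ⟨(1 + (r ^ 2 + s ^ 2 + t ^ 2))⁻¹ * (1 - (r ^ 2 + s ^ 2 + t ^ 2)),
    (1 + (r ^ 2 + s ^ 2 + t ^ 2))⁻¹ * (2 * r), (1 + (r ^ 2 + s ^ 2 + t ^ 2))⁻¹ * (2 * s),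
    (1 + (r ^ 2 + s ^ 2 + t ^ 2))⁻¹ * (2 * t)⟩

theorem normSq_invStereo (r s t : ℝ) : Quaternion.normSq (invStereo r s t) = 1 := by
  have : 1 + (r ^ 2 + s ^ 2 + t ^ 2) ≠ 0 := by positivity
  rw [Quaternion.normSq_def']
  simp only [invStereo]
  field_simp
  ring

theorem one_add_re_invStereo (r s t : ℝ) :
    1 + (invStereo r s t).re = 2 * (1 + (r ^ 2 + s ^ 2 + t ^ 2))⁻¹ := by
  have : 1 + (r ^ 2 + s ^ 2 + t ^ 2) ≠ 0 := by positivity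
  simp only [invStereo]
  field_simp
  ring

theorem invStereo_stereo (y : ℍ[ℝ]) (hy : Quaternion.normSq y = 1) (h : 1 + y.re ≠ 0) :
    invStereo (y.imI / (1 + y.re)) (y.imJ / (1 + y.re)) (y.imK / (1 + y.re)) = y := by
  rw [Quaternion.normSq_def'] at hy
  have hs : 1 + ((y.imI / (1 + y.re)) ^ 2 + (y.imJ / (1 + y.re)) ^ 2 + (y.imK / (1 + y.re)) ^ 2)
      = 2 / (1 + y.re) := by
    field_simp
    linear_combination hy
  have hs' : (y.imI / (1 + y.re)) ^ 2 + (y.imJ / (1 + y.re)) ^ 2 + (y.imK / (1 + y.re)) ^ 2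
      = 2 / (1 + y.re) - 1 := by linarith
  unfold invStereo
  rw [hs, hs']
  ext <;> simp <;> field_simp
  ring

/-- The element of `Sp(1,1)` with upper right entry `c` and diagonal `√(1+|c|²) (y, w)`. -/
def SpOneOne.build (c y w : ℍ[ℝ]) (hy : Quaternion.normSq y = 1) (hw : Quaternion.normSq w = 1) :
    SpOneOne :=
  ⟨!![rad c • y, c; w * star c * y, rad c • w], by
    change _ * _ * _ = _
    have hy' : star y * y = 1 := by rw [Quaternion.star_mul_self, hy]; rfl
    have hw' : star w * w = 1 := by rw [Quaternion.star_mul_self, hw]; rfl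
    have hc : c * star c = ((Quaternion.normSq c : ℝ) : ℍ[ℝ]) := Quaternion.self_mul_star c
    have hc' : star c * c = ((Quaternion.normSq c : ℝ) : ℍ[ℝ]) := Quaternion.star_mul_self c
    ext1 i j
    fin_cases i <;> fin_cases j
    · simp [signatureMatrix, Matrix.mul_apply, Fin.sum_univ_two, smul_smul, rad_sq, hy']
      have : star y * (c * star w) * (w * star c * y)
          = star y * (c * (star w * w) * star c) * y := by simp only [mul_assoc]
      rw [this, hw', mul_one, hc, mul_assoc, Quaternion.coe_mul_eq_smul, mul_smul_comm, hy',
        add_smul, one_smul]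
      abel
    · simp [signatureMatrix, Matrix.mul_apply, Fin.sum_univ_two]
      have : star y * (c * star w) * w = star y * c * (star w * w) := by simp only [mul_assoc]
      rw [this, hw', mul_one]
      simp
    · simp [signatureMatrix, Matrix.mul_apply, Fin.sum_univ_two]
      have : star w * (w * star c * y) = (star w * w) * (star c * y) := by simp only [mul_assoc]
      rw [this, hw', one_mul]
      simp
    · simp [signatureMatrix, Matrix.mul_apply, Fin.sum_univ_two, smul_smul, rad_sq, hw', hc',
        add_smul]
      rw [← Quaternion.algebraMap_def, Algebra.algebraMap_eq_smul_one]
      abel⟩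

@[fun_prop]
theorem contDiff_quaternion_re : ContDiff ℝ ∞ (fun q : ℍ[ℝ] => q.re) := by
  let L : ℍ[ℝ] →ₗ[ℝ] ℝ := QuaternionAlgebra.reₗ (R := ℝ) (-1) 0 (-1)
  exact L.toContinuousLinearMap.contDiff

@[fun_prop]
theorem contDiff_quaternion_imI : ContDiff ℝ ∞ (fun q : ℍ[ℝ] => q.imI) := by
  let L : ℍ[ℝ] →ₗ[ℝ] ℝ := QuaternionAlgebra.imIₗ (R := ℝ) (-1) 0 (-1)
  exact L.toContinuousLinearMap.contDiff

@[fun_prop]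
theorem contDiff_quaternion_imJ : ContDiff ℝ ∞ (fun q : ℍ[ℝ] => q.imJ) := by
  let L : ℍ[ℝ] →ₗ[ℝ] ℝ := QuaternionAlgebra.imJₗ (R := ℝ) (-1) 0 (-1)
  exact L.toContinuousLinearMap.contDiff

@[fun_prop]
theorem contDiff_quaternion_imK : ContDiff ℝ ∞ (fun q : ℍ[ℝ] => q.imK) := by
  let L : ℍ[ℝ] →ₗ[ℝ] ℝ := QuaternionAlgebra.imKₗ (R := ℝ) (-1) 0 (-1)
  exact L.toContinuousLinearMap.contDiff

theorem contDiff_quaternion_mk {F : Type*} [NormedAddCommGroup F] [NormedSpace ℝ F]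
    {f g h k : F → ℝ} (hf : ContDiff ℝ ∞ f) (hg : ContDiff ℝ ∞ g) (hh : ContDiff ℝ ∞ h)
    (hk : ContDiff ℝ ∞ k) : 
    ContDiff (F := ℍ[ℝ]) ℝ ∞ (fun x => ⟨f x, g x, h x, k x⟩) := by
  have h1 : ContDiff ℝ ∞ (fun x => ![f x, g x, h x, k x]) := by
    rw [contDiff_pi]
    intro i
    fin_cases i <;> assumption
  let L : (Fin 4 → ℝ) →ₗ[ℝ] ℍ[ℝ] :=
    (QuaternionAlgebra.linearEquivTuple (R := ℝ) (-1) 0 (-1)).symm.toLinearMap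
  exact L.toContinuousLinearMap.contDiff.comp h1

@[fun_prop]
theorem contDiff_quaternion_star : ContDiff ℝ ∞ (fun q : ℍ[ℝ] => star q) := by
  have h : (fun q : ℍ[ℝ] => star q) = fun q => ⟨q.re, -q.imI, -q.imJ, -q.imK⟩ := by
    funext q
    ext <;> simp
  rw [h]
  refine contDiff_quaternion_mk ?_ ?_ ?_ ?_ <;> fun_prop

@[fun_prop]
theorem contDiff_rad : ContDiff ℝ ∞ (fun c => rad c) := by
  unfold rad
  refine ContDiff.sqrt ?_ ?_
  · simp only [Quaternion.normSq_def']
    fun_prop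
  · intro c
    have := Quaternion.normSq_nonneg (a := c)
    positivity

theorem contDiff_entry (i j : Fin 2) :
    ContDiff ℝ ∞ (fun A : Matrix (Fin 2) (Fin 2) ℍ[ℝ] => A i j) :=
  (Matrix.entryLinearMap ℝ ℍ[ℝ] i j).toContinuousLinearMap.contDiff

theorem contDiff_matrix {F : Type*} [NormedAddCommGroup F] [NormedSpace ℝ F]
    {f : F → Matrix (Fin 2) (Fin 2) ℍ[ℝ]} (h : ∀ i j, ContDiff ℝ ∞ (fun x => f x i j)) :
    ContDiff ℝ ∞ f :=
  contDiff_pi.2 fun i => contDiff_pi.2 fun j => h i j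

/-- Stereographic coordinates of a quaternion, together with four further real coordinates. -/
def stereoCoord (p : ℍ[ℝ]) : Fin 3 → ℝ :=
  ![p.imI / (1 + p.re), p.imJ / (1 + p.re), p.imK / (1 + p.re)]

/-- The coordinates on `Sp(1,1)` near the identity. -/
def SpOneOne.coord (A : Matrix (Fin 2) (Fin 2) ℍ[ℝ]) : EuclideanSpace ℝ (Fin 10) :=
  let c := A 0 1
  let p := stereoCoord ((rad c)⁻¹ • A 0 0)
  let q := stereoCoord ((rad c)⁻¹ • A 1 1)
  !₂[c.re, c.imI, c.imJ, c.imK, p 0, p 1, p 2, q 0, q 1, q 2]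

/-- The inverse of `SpOneOne.coord`. -/
def SpOneOne.param (x : EuclideanSpace ℝ (Fin 10)) : SpOneOne :=
  SpOneOne.build ⟨x 0, x 1, x 2, x 3⟩ (invStereo (x 4) (x 5) (x 6)) (invStereo (x 7) (x 8) (x 9))
    (normSq_invStereo _ _ _) (normSq_invStereo _ _ _)

/-- The coordinates on `Sp(1,1) / Sp(1) I₂` near the class of the identity. -/
def SpOneOne.qcoord (A : Matrix (Fin 2) (Fin 2) ℍ[ℝ]) : EuclideanSpace ℝ (Fin 7) :=
  let r := (rad (A 0 1))⁻¹
  let c := r • (A 0 1 * star (A 1 1))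
  let p := stereoCoord ((r * r) • (A 0 0 * star (A 1 1)))
  !₂[c.re, c.imI, c.imJ, c.imK, p 0, p 1, p 2]

/-- The local section of `Sp(1,1) → Sp(1,1) / Sp(1) I₂` that is inverse to `SpOneOne.qcoord`. -/
def SpOneOne.qparam (x : EuclideanSpace ℝ (Fin 7)) : SpOneOne :=
  SpOneOne.build ⟨x 0, x 1, x 2, x 3⟩ (invStereo (x 4) (x 5) (x 6)) 1
    (normSq_invStereo _ _ _) (by simp)

theorem contDiff_coord_apply {n : ℕ} (i : Fin n) :
    ContDiff ℝ ∞ (fun x : EuclideanSpace ℝ (Fin n) => x i) := by fun_prop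

theorem contDiff_invStereo {F : Type*} [NormedAddCommGroup F] [NormedSpace ℝ F]
    {f g h : F → ℝ} (hf : ContDiff ℝ ∞ f) (hg : ContDiff ℝ ∞ g) (hh : ContDiff ℝ ∞ h) :
    ContDiff ℝ ∞ (fun x => invStereo (f x) (g x) (h x)) := by
  have h1 : ContDiff ℝ ∞ (fun x => (1 + (f x ^ 2 + g x ^ 2 + h x ^ 2))⁻¹) :=
    ContDiff.inv (by fun_prop) (fun x => by positivity)
  refine contDiff_quaternion_mk ?_ ?_ ?_ ?_ <;> fun_prop

theorem contDiff_build {F : Type*} [NormedAddCommGroup F] [NormedSpace ℝ F]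
    {c y w : F → ℍ[ℝ]} (hc : ContDiff ℝ ∞ c) (hy : ContDiff ℝ ∞ y) (hw : ContDiff ℝ ∞ w)
    (hy' : ∀ x, Quaternion.normSq (y x) = 1) (hw' : ∀ x, Quaternion.normSq (w x) = 1) :
    ContDiff ℝ ∞ (fun x => (SpOneOne.build (c x) (y x) (w x) (hy' x) (hw' x)).1) := by
  refine contDiff_matrix fun i j => ?_
  fin_cases i <;> fin_cases j <;> simp [SpOneOne.build] <;> fun_prop

theorem SpOneOne.contDiff_param :
    ContDiff ℝ ∞ (fun x => (SpOneOne.param x : Matrix (Fin 2) (Fin 2) ℍ[ℝ])) :=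
  contDiff_build (contDiff_quaternion_mk (contDiff_coord_apply _) (contDiff_coord_apply _) (contDiff_coord_apply _)
    (contDiff_coord_apply _))
    (contDiff_invStereo (contDiff_coord_apply 4) (contDiff_coord_apply 5) (contDiff_coord_apply 6))
    (contDiff_invStereo (contDiff_coord_apply 7) (contDiff_coord_apply 8) (contDiff_coord_apply 9)) _ _

theorem SpOneOne.contDiff_qparam :
    ContDiff ℝ ∞ (fun x => (SpOneOne.qparam x : Matrix (Fin 2) (Fin 2) ℍ[ℝ])) :=
  contDiff_build (contDiff_quaternion_mk (contDiff_coord_apply _) (contDiff_coord_apply _) (contDiff_coord_apply _)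
    (contDiff_coord_apply _))
    (contDiff_invStereo (contDiff_coord_apply 4) (contDiff_coord_apply 5) (contDiff_coord_apply 6))
    contDiff_const _ _

/-- The domain of `SpOneOne.coord`. -/
def SpOneOne.coordDomain : Set (Matrix (Fin 2) (Fin 2) ℍ[ℝ]) :=
  {A | 1 + ((rad (A 0 1))⁻¹ • A 0 0).re ≠ 0 ∧ 1 + ((rad (A 0 1))⁻¹ • A 1 1).re ≠ 0}

/-- The domain of `SpOneOne.qcoord`. -/
def SpOneOne.qcoordDomain : Set (Matrix (Fin 2) (Fin 2) ℍ[ℝ]) :=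
  {A | 1 + (((rad (A 0 1))⁻¹ * (rad (A 0 1))⁻¹) • (A 0 0 * star (A 1 1))).re ≠ 0}

theorem contDiff_inv_rad :
    ContDiff ℝ ∞ (fun A : Matrix (Fin 2) (Fin 2) ℍ[ℝ] => (rad (A 0 1))⁻¹) :=
  ContDiff.inv (contDiff_rad.comp (contDiff_entry 0 1)) fun _ => (rad_pos _).ne'

theorem contDiff_norm_diag (i : Fin 2) :
    ContDiff ℝ ∞ (fun A : Matrix (Fin 2) (Fin 2) ℍ[ℝ] => (rad (A 0 1))⁻¹ • A i i) :=
  contDiff_inv_rad.smul (contDiff_entry i i)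

theorem contDiff_norm_upper :
    ContDiff ℝ ∞ (fun A : Matrix (Fin 2) (Fin 2) ℍ[ℝ] =>
      (rad (A 0 1))⁻¹ • (A 0 1 * star (A 1 1))) :=
  contDiff_inv_rad.smul ((contDiff_entry 0 1).mul
    (contDiff_quaternion_star.comp (contDiff_entry 1 1)))

theorem contDiff_norm_first :
    ContDiff ℝ ∞ (fun A : Matrix (Fin 2) (Fin 2) ℍ[ℝ] =>
      ((rad (A 0 1))⁻¹ * (rad (A 0 1))⁻¹) • (A 0 0 * star (A 1 1))) :=
  (contDiff_inv_rad.mul contDiff_inv_rad).smul ((contDiff_entry 0 0).mul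
    (contDiff_quaternion_star.comp (contDiff_entry 1 1)))

theorem SpOneOne.isOpen_coordDomain : IsOpen SpOneOne.coordDomain :=
  IsOpen.inter
    (isOpen_ne_fun (continuous_const.add (contDiff_quaternion_re.comp
      (contDiff_norm_diag 0)).continuous) continuous_const)
    (isOpen_ne_fun (continuous_const.add (contDiff_quaternion_re.comp
      (contDiff_norm_diag 1)).continuous) continuous_const)

theorem SpOneOne.isOpen_qcoordDomain : IsOpen SpOneOne.qcoordDomain :=
  isOpen_ne_fun (continuous_const.add (contDiff_quaternion_re.comp
    contDiff_norm_first).continuous) continuous_const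

theorem contDiffOn_stereoCoord {F : Type*} [NormedAddCommGroup F] [NormedSpace ℝ F]
    {f : F → ℍ[ℝ]} (hf : ContDiff ℝ ∞ f) {U : Set F} (hU : ∀ x ∈ U, 1 + (f x).re ≠ 0) (i : Fin 3) :
    ContDiffOn ℝ ∞ (fun x => stereoCoord (f x) i) U := by
  fin_cases i <;> simp [stereoCoord] <;>
    exact ContDiffOn.div (by fun_prop) (by fun_prop) hU

theorem SpOneOne.contDiffOn_coord :
    ContDiffOn ℝ ∞ SpOneOne.coord SpOneOne.coordDomain := by
  rw [contDiffOn_euclidean]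
  have hp := contDiffOn_stereoCoord (U := SpOneOne.coordDomain)
    (contDiff_norm_diag 0) (fun x hx => hx.1)
  have hq := contDiffOn_stereoCoord (U := SpOneOne.coordDomain)
    (contDiff_norm_diag 1) (fun x hx => hx.2)
  intro i
  fin_cases i
  · exact (contDiff_quaternion_re.comp (contDiff_entry 0 1)).contDiffOn
  · exact (contDiff_quaternion_imI.comp (contDiff_entry 0 1)).contDiffOn
  · exact (contDiff_quaternion_imJ.comp (contDiff_entry 0 1)).contDiffOn
  · exact (contDiff_quaternion_imK.comp (contDiff_entry 0 1)).contDiffOn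
  · exact hp 0
  · exact hp 1
  · exact hp 2
  · exact hq 0
  · exact hq 1
  · exact hq 2

theorem SpOneOne.contDiffOn_qcoord :
    ContDiffOn ℝ ∞ SpOneOne.qcoord SpOneOne.qcoordDomain := by
  rw [contDiffOn_euclidean]
  have hp := contDiffOn_stereoCoord (U := SpOneOne.qcoordDomain)
    contDiff_norm_first (fun x hx => hx)
  have hc := contDiff_norm_upper
  intro i
  fin_cases i
  · exact (contDiff_quaternion_re.comp hc).contDiffOn
  · exact (contDiff_quaternion_imI.comp hc).contDiffOn
  · exact (contDiff_quaternion_imJ.comp hc).contDiffOn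
  · exact (contDiff_quaternion_imK.comp hc).contDiffOn
  · exact hp 0
  · exact hp 1
  · exact hp 2

theorem SpOneOne.ext_norm {A B : SpOneOne} (h1 : A.1 0 1 = B.1 0 1)
    (h0 : (rad (A.1 0 1))⁻¹ • A.1 0 0 = (rad (B.1 0 1))⁻¹ • B.1 0 0)
    (h2 : (rad (A.1 0 1))⁻¹ • A.1 1 1 = (rad (B.1 0 1))⁻¹ • B.1 1 1) : A = B := by
  have hr : (rad (B.1 0 1))⁻¹ ≠ 0 := inv_ne_zero (rad_pos _).ne'
  rw [h1] at h0 h2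
  exact SpOneOne.ext' (smul_right_injective _ hr h0) h1 (smul_right_injective _ hr h2)

theorem SpOneOne.normSq_diag (A : SpOneOne) :
    Quaternion.normSq ((rad (A.1 0 1))⁻¹ • A.1 0 0) = 1 ∧
      Quaternion.normSq ((rad (A.1 0 1))⁻¹ • A.1 1 1) = 1 := by
  obtain ⟨h1, h0, -⟩ := SpOneOne.rel A.2
  have hr := (rad_pos (A.1 0 1)).ne'
  rw [Quaternion.normSq_smul, Quaternion.normSq_smul, h0, h1, ← rad_sq]
  constructor <;> field_simp

theorem SpOneOne.build_norm (c y w : ℍ[ℝ]) (hy : Quaternion.normSq y = 1)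
    (hw : Quaternion.normSq w = 1) :
    (SpOneOne.build c y w hy hw).1 0 1 = c ∧
    (rad c)⁻¹ • (SpOneOne.build c y w hy hw).1 0 0 = y ∧
    (rad c)⁻¹ • (SpOneOne.build c y w hy hw).1 1 1 = w := by
  have hr := (rad_pos c).ne'
  refine ⟨rfl, ?_, ?_⟩ <;> simp [SpOneOne.build, smul_smul, inv_mul_cancel₀ hr]

theorem stereoCoord_invStereo (r s t : ℝ) : stereoCoord (invStereo r s t) = ![r, s, t] := by
  have h := one_add_re_invStereo r s t
  have : 1 + (r ^ 2 + s ^ 2 + t ^ 2) ≠ 0 := by positivity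
  unfold stereoCoord
  rw [h]
  funext i
  fin_cases i <;> simp [invStereo] <;> field_simp

theorem SpOneOne.param_coord (A : SpOneOne) (hA : A.1 ∈ SpOneOne.coordDomain) :
    SpOneOne.param (SpOneOne.coord A.1) = A := by
  obtain ⟨hp, hq⟩ := SpOneOne.normSq_diag A
  obtain ⟨h1, h0, h2⟩ := SpOneOne.build_norm (A.1 0 1) _ _ hp hq
  have key : SpOneOne.param (SpOneOne.coord A.1) = SpOneOne.build (A.1 0 1) _ _ hp hq := by
    have e1 := invStereo_stereo _ hp hA.1
    have e2 := invStereo_stereo _ hq hA.2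
    unfold SpOneOne.param
    congr 1
  rw [key]
  exact SpOneOne.ext_norm h1 h0 h2

theorem SpOneOne.param_mem (x : EuclideanSpace ℝ (Fin 10)) :
    (SpOneOne.param x).1 ∈ SpOneOne.coordDomain := by
  obtain ⟨h1, h0, h2⟩ := SpOneOne.build_norm ⟨x 0, x 1, x 2, x 3⟩ _ _
    (normSq_invStereo (x 4) (x 5) (x 6)) (normSq_invStereo (x 7) (x 8) (x 9))
  constructor
  · change 1 + ((rad (⟨x 0, x 1, x 2, x 3⟩))⁻¹ • (SpOneOne.build _ _ _ _ _).1 0 0).re ≠ 0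
    rw [h0, one_add_re_invStereo]
    positivity
  · change 1 + ((rad (⟨x 0, x 1, x 2, x 3⟩))⁻¹ • (SpOneOne.build _ _ _ _ _).1 1 1).re ≠ 0
    rw [h2, one_add_re_invStereo]
    positivity

theorem SpOneOne.coord_param (x : EuclideanSpace ℝ (Fin 10)) :
    SpOneOne.coord (SpOneOne.param x).1 = x := by
  obtain ⟨h1, h0, h2⟩ := SpOneOne.build_norm ⟨x 0, x 1, x 2, x 3⟩ _ _
    (normSq_invStereo (x 4) (x 5) (x 6)) (normSq_invStereo (x 7) (x 8) (x 9))
  have e0 : stereoCoord ((rad ((SpOneOne.param x).1 0 1))⁻¹ • (SpOneOne.param x).1 0 0) =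
      ![x 4, x 5, x 6] := by
    rw [← stereoCoord_invStereo]; exact congrArg stereoCoord h0
  have e2 : stereoCoord ((rad ((SpOneOne.param x).1 0 1))⁻¹ • (SpOneOne.param x).1 1 1) =
      ![x 7, x 8, x 9] := by
    rw [← stereoCoord_invStereo]; exact congrArg stereoCoord h2
  have e1 : (SpOneOne.param x).1 0 1 = ⟨x 0, x 1, x 2, x 3⟩ := h1
  ext i
  simp only [SpOneOne.coord, e0, e2]
  fin_cases i <;> simp [e1]

/-- The chart of `Sp(1,1)` near the identity given by `SpOneOne.coord`. -/
def SpOneOne.chartOne : OpenPartialHomeomorph SpOneOne (EuclideanSpace ℝ (Fin 10)) where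
  toFun A := SpOneOne.coord A.1
  invFun := SpOneOne.param
  source := {A | A.1 ∈ SpOneOne.coordDomain}
  target := univ
  map_source' _ _ := mem_univ _
  map_target' x _ := SpOneOne.param_mem x
  left_inv' A hA := SpOneOne.param_coord A hA
  right_inv' x _ := SpOneOne.coord_param x
  open_source := SpOneOne.isOpen_coordDomain.preimage continuous_subtype_val
  open_target := isOpen_univ
  continuousOn_toFun :=
    SpOneOne.contDiffOn_coord.continuousOn.comp continuous_subtype_val.continuousOn fun _ h => h
  continuousOn_invFun :=
    (Continuous.subtype_mk SpOneOne.contDiff_param.continuous _).continuousOn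

theorem contDiff_mulLeft (B : Matrix (Fin 2) (Fin 2) ℍ[ℝ]) : ContDiff ℝ ∞ (fun A => B * A) :=
  (LinearMap.mulLeft ℝ B).toContinuousLinearMap.contDiff

theorem SpOneOne.exists_chart (g : SpOneOne) :
    ∃ e ∈ submanifoldAtlas SpOneOne (EuclideanSpace ℝ (Fin 10)), g ∈ e.source := by
  refine ⟨(Homeomorph.mulLeft g⁻¹).transOpenPartialHomeomorph SpOneOne.chartOne, ⟨?_, ?_⟩, ?_⟩
  · exact ((contDiff_mulLeft (g⁻¹)⁻¹.1).comp SpOneOne.contDiff_param).contDiffOn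
  · intro x hx
    exact ⟨_, fun A => SpOneOne.coord ((g⁻¹).1 * A),
      SpOneOne.isOpen_coordDomain.preimage (contDiff_mulLeft (g⁻¹).1).continuous, hx,
      SpOneOne.contDiffOn_coord.comp (contDiff_mulLeft (g⁻¹).1).contDiffOn fun _ h => h,
      fun _ _ _ => rfl⟩
  · change ((g⁻¹ * g : SpOneOne) : Matrix (Fin 2) (Fin 2) ℍ[ℝ]) ∈ SpOneOne.coordDomain
    rw [inv_mul_cancel, SpOneOne.coe_one]
    constructor <;> simp [rad]

/-- `Sp(1,1)` as an embedded submanifold of the space of `2 × 2` quaternionic matrices. -/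
instance : ChartedSpace (EuclideanSpace ℝ (Fin 10)) SpOneOne :=
  submanifoldChartedSpace SpOneOne SpOneOne.exists_chart

instance : IsManifold (𝓡 10) ∞ SpOneOne :=
  submanifold_isManifold SpOneOne SpOneOne.exists_chart

/-- The restriction to `Sp(1,1)` of a smooth map on the space of matrices is smooth. -/
theorem SpOneOne.contMDiffOn_restrict {F : Type*} [NormedAddCommGroup F] [NormedSpace ℝ F]
    {U : Set (Matrix (Fin 2) (Fin 2) ℍ[ℝ])} {f : Matrix (Fin 2) (Fin 2) ℍ[ℝ] → F}
    (hf : ContDiffOn ℝ ∞ f U) :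
    ContMDiffOn (𝓡 10) 𝓘(ℝ, F) ∞ (fun A : SpOneOne => f A.1) {A : SpOneOne | A.1 ∈ U} :=
  submanifold_contMDiffOn_restrict SpOneOne SpOneOne.exists_chart hf

/-- A map into `Sp(1,1)` that is smooth as a map into the space of matrices is smooth. -/
theorem SpOneOne.contMDiffOn_of_coe {F : Type*} [NormedAddCommGroup F] [NormedSpace ℝ F]
    {U : Set F} (hU : IsOpen U) {σ : F → SpOneOne}
    (hσ : ContDiffOn ℝ ∞ (fun x => (σ x).1) U) : ContMDiffOn 𝓘(ℝ, F) (𝓡 10) ∞ σ U :=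
  submanifold_contMDiffOn_of_coe SpOneOne SpOneOne.exists_chart hU hσ

/-- The projection `Sp(1,1) → Sp(1,1) / Sp(1) I₂`. -/
def SpOneOne.proj (A : SpOneOne) : SpOneOne ⧸ spOneScalar := QuotientGroup.mk A

theorem SpOneOne.mul_scalar {k : SpOneOne} {u : ℍ[ℝ]} (hk : k.1 = Matrix.diagonal fun _ => u)
    (A : SpOneOne) (i j : Fin 2) : (A * k).1 i j = A.1 i j * u := by
  rw [SpOneOne.coe_mul, hk, Matrix.mul_diagonal]

theorem SpOneOne.q_invariant {u : ℍ[ℝ]} (hu : ‖u‖ = 1) {A B : Matrix (Fin 2) (Fin 2) ℍ[ℝ]}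
    (h : ∀ i j, B i j = A i j * u) :
    rad (B 0 1) = rad (A 0 1) ∧ B 0 1 * star (B 1 1) = A 0 1 * star (A 1 1) ∧
      B 0 0 * star (B 1 1) = A 0 0 * star (A 1 1) := by
  have hu' : u * star u = 1 := by
    rw [Quaternion.self_mul_star, Quaternion.normSq_eq_norm_mul_self, hu]; simp
  have hn : Quaternion.normSq u = 1 := by rw [Quaternion.normSq_eq_norm_mul_self, hu]; simp
  refine ⟨?_, ?_, ?_⟩
  · simp [rad, h, hn]
  · rw [h, h, star_mul, mul_assoc, ← mul_assoc u, hu', one_mul]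
  · rw [h, h, star_mul, mul_assoc, ← mul_assoc u, hu', one_mul]

theorem SpOneOne.proj_rel {A B : SpOneOne} (h : SpOneOne.proj A = SpOneOne.proj B) :
    ∃ u : ℍ[ℝ], ‖u‖ = 1 ∧ ∀ i j, B.1 i j = A.1 i j * u := by
  obtain ⟨u, hu, hk⟩ := QuotientGroup.eq.1 h
  refine ⟨u, hu, fun i j => ?_⟩
  rw [← SpOneOne.mul_scalar hk, mul_inv_cancel_left]

theorem SpOneOne.qcoord_eq {A B : SpOneOne} (h : SpOneOne.proj A = SpOneOne.proj B) :
    SpOneOne.qcoord A.1 = SpOneOne.qcoord B.1 := by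
  obtain ⟨u, hu, hB⟩ := SpOneOne.proj_rel h
  obtain ⟨h1, h2, h3⟩ := SpOneOne.q_invariant hu hB
  simp only [SpOneOne.qcoord, h1, h2, h3]

theorem SpOneOne.qdomain_iff {A B : SpOneOne} (h : SpOneOne.proj A = SpOneOne.proj B) :
    A.1 ∈ SpOneOne.qcoordDomain ↔ B.1 ∈ SpOneOne.qcoordDomain := by
  obtain ⟨u, hu, hB⟩ := SpOneOne.proj_rel h
  obtain ⟨h1, h2, h3⟩ := SpOneOne.q_invariant hu hB
  simp only [SpOneOne.qcoordDomain, mem_ofPred_eq, h1, h3]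

theorem SpOneOne.qcoord_qparam (x : EuclideanSpace ℝ (Fin 7)) :
    (SpOneOne.qparam x).1 ∈ SpOneOne.qcoordDomain ∧
      SpOneOne.qcoord (SpOneOne.qparam x).1 = x := by
  obtain ⟨h1, h0, h2⟩ := SpOneOne.build_norm ⟨x 0, x 1, x 2, x 3⟩ _ 1
    (normSq_invStereo (x 4) (x 5) (x 6)) (by simp)
  set A := SpOneOne.qparam x with hA
  have e1 : A.1 0 1 = ⟨x 0, x 1, x 2, x 3⟩ := h1
  have e0 : (rad (A.1 0 1))⁻¹ • A.1 0 0 = invStereo (x 4) (x 5) (x 6) := h0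
  have e2 : (rad (A.1 0 1))⁻¹ • star (A.1 1 1) = 1 := by
    have : (rad (A.1 0 1))⁻¹ • A.1 1 1 = 1 := h2
    have := congrArg star this
    simpa [Quaternion.star_smul] using this
  have f1 : (rad (A.1 0 1))⁻¹ • (A.1 0 1 * star (A.1 1 1)) = A.1 0 1 := by
    rw [← mul_smul_comm, e2, mul_one]
  have f0 : ((rad (A.1 0 1))⁻¹ * (rad (A.1 0 1))⁻¹) • (A.1 0 0 * star (A.1 1 1)) =
      invStereo (x 4) (x 5) (x 6) := by
    rw [← smul_mul_smul_comm, e2, mul_one, e0]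
  constructor
  · change 1 + (((rad (A.1 0 1))⁻¹ * (rad (A.1 0 1))⁻¹) • (A.1 0 0 * star (A.1 1 1))).re ≠ 0
    rw [f0, one_add_re_invStereo]
    positivity
  · ext i
    simp only [SpOneOne.qcoord, f0, f1, stereoCoord_invStereo]
    fin_cases i <;> simp [e1]

theorem SpOneOne.proj_qparam_qcoord (A : SpOneOne) (hA : A.1 ∈ SpOneOne.qcoordDomain) :
    SpOneOne.proj (SpOneOne.qparam (SpOneOne.qcoord A.1)) = SpOneOne.proj A := by
  obtain ⟨hp, hq⟩ := SpOneOne.normSq_diag A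
  have hr := (rad_pos (A.1 0 1)).ne'
  set r := rad (A.1 0 1) with hrdef
  set u : ℍ[ℝ] := star (r⁻¹ • A.1 1 1) with hu
  have hu1 : Quaternion.normSq u = 1 := by rw [hu, Quaternion.normSq_star]; exact hq
  have hu2 : ‖u‖ = 1 := by
    have : ‖u‖ * ‖u‖ = 1 := by rw [← Quaternion.normSq_eq_norm_mul_self]; exact hu1
    nlinarith [norm_nonneg u]
  have hus : star u * u = 1 := by rw [Quaternion.star_mul_self, hu1]; rfl
  have hkm : (Matrix.diagonal fun _ => u : Matrix (Fin 2) (Fin 2) ℍ[ℝ]) ∈ SpOneOne := by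
    change _ * _ * _ = _
    rw [Matrix.diagonal_conjTranspose, mul_assoc]
    ext1 i j
    fin_cases i <;> fin_cases j <;>
      simp [signatureMatrix, hus]
  set k : SpOneOne := ⟨_, hkm⟩ with hk
  have hkK : k ∈ spOneScalar := ⟨u, hu2, rfl⟩
  have hAk : ∀ i j, (A * k).1 i j = A.1 i j * u := SpOneOne.mul_scalar rfl A
  have hu' : u = r⁻¹ • star (A.1 1 1) := by rw [hu, Quaternion.star_smul]
  obtain ⟨i1, -, -⟩ := SpOneOne.q_invariant hu2 hAk
  have k1 : (A * k).1 0 1 = r⁻¹ • (A.1 0 1 * star (A.1 1 1)) := by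
    rw [hAk, hu', mul_smul_comm]
  have k0 : (rad ((A * k).1 0 1))⁻¹ • (A * k).1 0 0 =
      (r⁻¹ * r⁻¹) • (A.1 0 0 * star (A.1 1 1)) := by
    rw [i1, hAk, hu', mul_smul_comm, smul_smul]
  have k2 : (rad ((A * k).1 0 1))⁻¹ • (A * k).1 1 1 = 1 := by
    rw [i1, hAk, ← smul_mul_assoc, hu, Quaternion.self_mul_star, hq]; rfl
  have hp' : Quaternion.normSq ((r⁻¹ * r⁻¹) • (A.1 0 0 * star (A.1 1 1))) = 1 := by
    rw [← k0]; exact (SpOneOne.normSq_diag (A * k)).1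
  have e1 := invStereo_stereo _ hp' hA
  obtain ⟨h1, h0, h2⟩ := SpOneOne.build_norm (r⁻¹ • (A.1 0 1 * star (A.1 1 1))) _ 1 hp' (by simp)
  have key : SpOneOne.qparam (SpOneOne.qcoord A.1) =
      SpOneOne.build (r⁻¹ • (A.1 0 1 * star (A.1 1 1))) _ 1 hp' (by simp) := by
    unfold SpOneOne.qparam
    congr 1
  have : SpOneOne.qparam (SpOneOne.qcoord A.1) = A * k := by
    rw [key]
    refine SpOneOne.ext_norm (h1.trans k1.symm) ?_ ?_
    · rw [k0]; exact h0
    · rw [k2]; exact h2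
  rw [this]
  exact (QuotientGroup.eq.2 (by simpa using hkK)).symm

/-- The chart of `Sp(1,1) / Sp(1) I₂` near the class of the identity. -/
def SpOneOne.qchartOne :
    OpenPartialHomeomorph (SpOneOne ⧸ spOneScalar) (EuclideanSpace ℝ (Fin 7)) where
  toFun := fun x => SpOneOne.qcoord x.out.1
  invFun x := SpOneOne.proj (SpOneOne.qparam x)
  source := {x | x.out.1 ∈ SpOneOne.qcoordDomain}
  target := univ
  map_source' _ _ := mem_univ _
  map_target' x _ :=
    (SpOneOne.qdomain_iff (QuotientGroup.out_eq' (SpOneOne.proj (SpOneOne.qparam x)))).2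
      (SpOneOne.qcoord_qparam x).1
  left_inv' x hx := (SpOneOne.proj_qparam_qcoord x.out hx).trans (QuotientGroup.out_eq' x)
  right_inv' x _ :=
    (SpOneOne.qcoord_eq (QuotientGroup.out_eq' (SpOneOne.proj (SpOneOne.qparam x)))).trans
      (SpOneOne.qcoord_qparam x).2
  open_source := by
    refine (QuotientGroup.isQuotientMap_mk (N := spOneScalar)).isOpen_preimage.1 ?_
    convert SpOneOne.isOpen_qcoordDomain.preimage continuous_subtype_val using 1
    ext A
    exact SpOneOne.qdomain_iff (QuotientGroup.out_eq' (SpOneOne.proj A))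
  open_target := isOpen_univ
  continuousOn_toFun := by
    have hop : IsOpen {x : SpOneOne ⧸ spOneScalar | x.out.1 ∈ SpOneOne.qcoordDomain} := by
      refine (QuotientGroup.isQuotientMap_mk (N := spOneScalar)).isOpen_preimage.1 ?_
      convert SpOneOne.isOpen_qcoordDomain.preimage continuous_subtype_val using 1
      ext A
      exact SpOneOne.qdomain_iff (QuotientGroup.out_eq' (SpOneOne.proj A))
    refine ((QuotientGroup.isQuotientMap_mk (N := spOneScalar)).continuousOn_isOpen_iff hop).2 ?_
    refine (SpOneOne.contDiffOn_qcoord.continuousOn.comp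
      continuous_subtype_val.continuousOn ?_).congr ?_ (f := fun A : SpOneOne => SpOneOne.qcoord A.1)
    · exact fun A hA => (SpOneOne.qdomain_iff (QuotientGroup.out_eq' (SpOneOne.proj A))).1 hA
    · exact fun A _ => SpOneOne.qcoord_eq (QuotientGroup.out_eq' (SpOneOne.proj A))
  continuousOn_invFun :=
    (continuous_quotient_mk'.comp
      (Continuous.subtype_mk SpOneOne.contDiff_qparam.continuous _)).continuousOn

theorem SpOneOne.exists_qchart (x : SpOneOne ⧸ spOneScalar) :
    ∃ e ∈ quotientAtlas (EuclideanSpace ℝ (Fin 10)) (EuclideanSpace ℝ (Fin 7)) SpOneOne.proj,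
      x ∈ e.source := by
  obtain ⟨g, rfl⟩ := QuotientGroup.mk_surjective x
  have hout : ∀ A : SpOneOne, SpOneOne.proj ((g⁻¹ • SpOneOne.proj A).out) =
      SpOneOne.proj (g⁻¹ * A) := fun A => QuotientGroup.out_eq' _
  refine ⟨(Homeomorph.smul g⁻¹).transOpenPartialHomeomorph SpOneOne.qchartOne, ⟨?_, ?_⟩, ?_⟩
  · have h1 : ContDiffOn ℝ ∞ (SpOneOne.qcoord ∘ fun A => (g⁻¹).1 * A)
        ((fun A => (g⁻¹).1 * A) ⁻¹' SpOneOne.qcoordDomain) :=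
      SpOneOne.contDiffOn_qcoord.comp (contDiff_mulLeft (g⁻¹).1).contDiffOn
        (mapsTo_preimage _ _)
    have h2 := SpOneOne.contMDiffOn_restrict h1
    refine (h2.mono ?_).congr ?_
    · intro A hA
      exact (SpOneOne.qdomain_iff (hout A)).1 hA
    · intro A _
      have h3 : SpOneOne.qcoord (g⁻¹ • SpOneOne.proj A).out.1 = SpOneOne.qcoord (g⁻¹ * A).1 :=
        SpOneOne.qcoord_eq (hout A)
      rw [SpOneOne.coe_mul] at h3
      exact h3
  · intro y _
    refine ⟨univ, fun z => (g⁻¹)⁻¹ * SpOneOne.qparam z, isOpen_univ, mem_univ _, fun z _ => mem_univ _,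
      ?_, fun _ _ => rfl⟩
    refine SpOneOne.contMDiffOn_of_coe isOpen_univ ?_
    exact ((contDiff_mulLeft (g⁻¹)⁻¹.1).comp SpOneOne.contDiff_qparam).contDiffOn
  · refine (SpOneOne.qdomain_iff (hout g)).2 ?_
    rw [inv_mul_cancel, SpOneOne.coe_one]
    change (1 : ℝ) + _ ≠ 0
    simp [rad]

/-- The quotient `Sp(1,1) / Sp(1) I₂` as the base of the submersion `Sp(1,1) → Sp(1,1) / Sp(1) I₂`. -/
instance : ChartedSpace (EuclideanSpace ℝ (Fin 7)) (SpOneOne ⧸ spOneScalar) :=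
  quotientChartedSpace SpOneOne.proj SpOneOne.exists_qchart

instance : IsManifold (𝓡 7) ∞ (SpOneOne ⧸ spOneScalar) :=
  quotient_isManifold SpOneOne.proj continuous_quotient_mk' SpOneOne.exists_qchart

/-! ### Slice regular functions and regular Möbius transformations -/

/-- The open unit ball of the quaternions. -/
def unitBall : TopologicalSpace.Opens ℍ[ℝ] := ⟨Metric.ball 0 1, Metric.isOpen_ball⟩

/-- `f` has the power series expansion `f q = ∑ qⁿ aₙ` on the unit ball. The slice regular functions
on the unit ball are exactly the functions that have such an expansion. -/
def HasRegularExpansion (f : unitBall → ℍ[ℝ]) (a : ℕ → ℍ[ℝ]) : Prop :=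
  ∀ q : unitBall, HasSum (fun n => (q : ℍ[ℝ]) ^ n * a n) (f q)

open Classical in
/-- The coefficients of the power series expansion of a slice regular function (and `0` for a
function without expansion). -/
def regularCoeff (f : unitBall → ℍ[ℝ]) : ℕ → ℍ[ℝ] :=
  if h : ∃ a, HasRegularExpansion f a then h.choose else 0

theorem HasRegularExpansion.unique {f : unitBall → ℍ[ℝ]} {a b : ℕ → ℍ[ℝ]}
    (ha : HasRegularExpansion f a) (hb : HasRegularExpansion f b) : a = b := by
  classical
  have key : ∀ c : ℕ → ℍ[ℝ], HasRegularExpansion f c → HasFPowerSeriesAt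
      (fun x : ℝ => if h : (x : ℍ[ℝ]) ∈ unitBall then f ⟨x, h⟩ else 0)
      (fun n => ContinuousMultilinearMap.mkPiRing ℝ (Fin n) (c n) :
        FormalMultilinearSeries ℝ ℝ ℍ[ℝ]) 0 := by
    intro c hc
    refine hasFPowerSeriesAt_iff.2 ?_
    have hmem : ∀ᶠ x : ℝ in 𝓝 0, (x : ℍ[ℝ]) ∈ unitBall :=
      (Quaternion.continuous_coe.tendsto 0).eventually
        (unitBall.isOpen.mem_nhds (by simp [unitBall]))
    filter_upwards [hmem] with x hx
    have := hc ⟨x, hx⟩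
    simp only [zero_add, hx, dite_true]
    have hn : (fun n => ((⟨x, hx⟩ : unitBall) : ℍ[ℝ]) ^ n * c n) = fun n => x ^ n • c n := by
      funext n
      rw [← Quaternion.coe_mul_eq_smul, Quaternion.coe_pow]
    rw [hn] at this
    simpa [FormalMultilinearSeries.coeff] using this
  have h := (key a ha).eq_formalMultilinearSeries (key b hb)
  funext n
  have := congrArg (fun p => p n (fun _ => (1 : ℝ))) h
  simpa using this

theorem HasRegularExpansion.regularCoeff_eq {f : unitBall → ℍ[ℝ]} {a : ℕ → ℍ[ℝ]}
    (ha : HasRegularExpansion f a) : regularCoeff f = a := by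
  have h : ∃ a, HasRegularExpansion f a := ⟨a, ha⟩
  rw [regularCoeff, dif_pos h]
  exact h.choose_spec.unique ha

/-- The regular product `f * g`. -/
def starMul (f g : unitBall → ℍ[ℝ]) : unitBall → ℍ[ℝ] := fun q =>
  ∑' n : ℕ, (q : ℍ[ℝ]) ^ n * ∑ k ∈ Finset.range (n + 1), regularCoeff f k * regularCoeff g (n - k)

/-- The regular conjugate `f^c`. -/
def regularConj (f : unitBall → ℍ[ℝ]) : unitBall → ℍ[ℝ] := fun q =>
  ∑' n : ℕ, (q : ℍ[ℝ]) ^ n * star (regularCoeff f n)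

/-- The symmetrization `f^s = f * f^c`. -/
def symmetrization (f : unitBall → ℍ[ℝ]) : unitBall → ℍ[ℝ] := starMul f (regularConj f)

/-- The regular reciprocal `f^{-*} = (1 / f^s) f^c`. It is meaningful when `f^s` has no zeros. -/
def starInv (f : unitBall → ℍ[ℝ]) : unitBall → ℍ[ℝ] := fun q =>
  (symmetrization f q)⁻¹ * regularConj f q

/-- The function `q ↦ q a + b`. -/
def regularLinear (a b : ℍ[ℝ]) : unitBall → ℍ[ℝ] := fun q => q * a + b

/-- The regular Möbius transformation `(q c + d)^{-*} * (q a + b)` of the matrix with rows `(a, c)`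
and `(b, d)`. -/
def regularMobius (A : Matrix (Fin 2) (Fin 2) ℍ[ℝ]) : unitBall → ℍ[ℝ] :=
  starMul (starInv (regularLinear (A 0 1) (A 1 1))) (regularLinear (A 0 0) (A 1 0))

/-- The family `𝓜(𝔹)` of all regular Möbius transformations of the unit ball. -/
def RegularMobius : Type :=
  {f : unitBall → ℍ[ℝ] // ∃ A : SpOneOne, f = regularMobius A.1}

/-- The function `q ↦ (1 - q ā)^{-*} * (q - a) u` on the unit ball. -/
def mobiusParam (a u : ℍ[ℝ]) : unitBall → ℍ[ℝ] :=
  starMul (starInv fun q => 1 - q * star a) fun q => (q - a) * u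

/-- A manifold structure on `𝓜(𝔹)` is the one induced by `Sp(1,1) / Sp(1) I₂` if
`A Sp(1) I₂ ↦ 𝓕_{A⁻¹}` is a well-defined diffeomorphism onto `𝓜(𝔹)`. -/
def IsInducedStructure [TopologicalSpace RegularMobius]
    [ChartedSpace (EuclideanSpace ℝ (Fin 7)) RegularMobius] : Prop :=
  IsManifold (𝓡 7) ∞ RegularMobius ∧
    ∃ Ψ : (SpOneOne ⧸ spOneScalar) ≃ₘ⟮𝓡 7, 𝓡 7⟯ RegularMobius,
      ∀ A : SpOneOne, (Ψ (SpOneOne.proj A)).1 = regularMobius (A⁻¹ : SpOneOne).1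

/-- The quaternions have real dimension `3 + 1`. -/
instance : Fact (Module.finrank ℝ ℍ[ℝ] = 3 + 1) := ⟨Quaternion.finrank_eq_four⟩

end

noncomputable section

/-! ### Regular power series -/

/-! Let `A` have rows (a, c) and (b, d). The inverse has rows (ā, -b̄) and (-c̄, d̄), so 𝓕_{A⁻¹} =
(d̄ - q b̄)^{-*} * (q ā - c̄). A common left factor d̄ cancels from such a quotient, and the
relations defining Sp(1,1) turn what is left into φ(b d⁻¹, conj (a d⁻¹)) (`regularMobius_inv`). Both
arguments are unchanged when `A` is multiplied on the right by a unit scalar. Everything thus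
reduces to two facts: these two quantities give a diffeomorphism from the quotient onto 𝔹 × Sp(1),
and φ is injective.

For the first fact, replace b d⁻¹ by x = b d̄ / |d|. Since |d|² = 1 + |b|², the two differ by the
diffeomorphism x ↦ x / √(1 + |x|²) from ℍ onto 𝔹. With v = conj (a d⁻¹), each coset contains exactly
one matrix whose lower right entry is a positive real r, namely the one with rows (r v̄, v̄ x̄) and
(x, r), where r = √(1 + |x|²). This gives a smooth global section (`SpOneOne.polarSection`), inverse
modulo Sp(1) to the smooth invariants `SpOneOne.polar`. Right translates of the section pass through
every point of Sp(1,1), whence the submersion property.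

The second fact is read off from power series. The regular reciprocal of d - q d p is ∑ qⁿ pⁿ d⁻¹
(`hasRegularExpansion_starInv_linear`), because p is a root of the real quadratic that gives the
symmetrization. Hence φ(a, u) starts with -a u + q (1 - |a|²) u, and these two coefficients
determine a and u (`mobiusParam_injective`).

The manifold structure on 𝓜(𝔹) is then carried over from the quotient. For any induced structure, φ
is the composite of the two diffeomorphisms through the quotient. -/

theorem HasRegularExpansion.eq {f g : unitBall → ℍ[ℝ]} {a : ℕ → ℍ[ℝ]}
    (hf : HasRegularExpansion f a) (hg : HasRegularExpansion g a) : f = g :=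
  funext fun q => (hf q).unique (hg q)

theorem norm_coe_unitBall_lt (q : unitBall) : ‖(q : ℍ[ℝ])‖ < 1 :=
  mem_ball_zero_iff.1 q.2

/-- The coefficients of `q ↦ q a + b`. -/
def linearCoeff (a b : ℍ[ℝ]) (n : ℕ) : ℍ[ℝ] := if n = 0 then b else if n = 1 then a else 0

theorem hasRegularExpansion_linear (a b : ℍ[ℝ]) :
    HasRegularExpansion (regularLinear a b) (linearCoeff a b) := by
  intro q
  have h := hasSum_sum_of_ne_finset_zero (L := .unconditional ℕ) (f := fun n => (q : ℍ[ℝ]) ^ n * linearCoeff a b n)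
    (s := Finset.range 2) (fun n hn => by
      have : ¬ n < 2 := by simpa using hn
      simp [linearCoeff, show n ≠ 0 by omega, show n ≠ 1 by omega])
  simpa [Finset.sum_range_succ, linearCoeff, regularLinear, add_comm] using h

theorem regularCoeff_linear (a b : ℍ[ℝ]) :
    regularCoeff (regularLinear a b) = linearCoeff a b :=
  (hasRegularExpansion_linear a b).regularCoeff_eq

theorem regularConj_linear (a b : ℍ[ℝ]) :
    regularConj (regularLinear a b) = regularLinear (star a) (star b) := by
  funext q
  rw [← (hasRegularExpansion_linear (star a) (star b) q).tsum_eq, regularConj, regularCoeff_linear]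
  refine tsum_congr fun n => ?_
  unfold linearCoeff
  split_ifs <;> simp

/-- The coefficients of the regular product of `∑ qⁿ eₙ` and `q a + b`. -/
def mulLinearCoeff (e : ℕ → ℍ[ℝ]) (a b : ℍ[ℝ]) : ℕ → ℍ[ℝ]
  | 0 => e 0 * b
  | n + 1 => e (n + 1) * b + e n * a

theorem sum_mul_linearCoeff (e : ℕ → ℍ[ℝ]) (a b : ℍ[ℝ]) (n : ℕ) :
    ∑ k ∈ Finset.range (n + 1), e k * linearCoeff a b (n - k) = mulLinearCoeff e a b n := by
  rcases n with _ | n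
  · simp [linearCoeff, mulLinearCoeff]
  · rw [Finset.sum_range_succ, Finset.sum_range_succ, Finset.sum_eq_zero]
    · simp [linearCoeff, mulLinearCoeff, add_comm]
    · intro k hk
      have hk : k < n := by simpa using hk
      simp [linearCoeff, show n + 1 - k ≠ 0 by omega, show n + 1 - k ≠ 1 by omega]

theorem HasRegularExpansion.starMul_linear {f : unitBall → ℍ[ℝ]} {e : ℕ → ℍ[ℝ]}
    (hf : HasRegularExpansion f e) (a b : ℍ[ℝ]) :
    HasRegularExpansion (starMul f (regularLinear a b)) (mulLinearCoeff e a b) := by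
  intro q
  have h1 : HasSum (fun n => (q : ℍ[ℝ]) ^ n * e n * b) (f q * b) := (hf q).mul_right b
  have h2 : HasSum (fun n => (q : ℍ[ℝ]) * ((q : ℍ[ℝ]) ^ n * e n * a)) (q * (f q * a)) :=
    ((hf q).mul_right a).mul_left (q : ℍ[ℝ])
  -- Dropping the constant term of f(q) b aligns it with q f(q) a: both series then have terms of
  -- degree n + 1. Only summability is needed from here, the regular product being defined as a sum.
  have h3 := ((hasSum_nat_add_iff' 1).2 h1).add h2
  have h4 : HasSum (fun n => (q : ℍ[ℝ]) ^ (n + 1) * mulLinearCoeff e a b (n + 1))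
      (f q * b - ∑ i ∈ Finset.range 1, (q : ℍ[ℝ]) ^ i * e i * b + q * (f q * a)) := by
    refine h3.congr_fun fun n => ?_
    simp only [mulLinearCoeff, pow_succ', mul_add, mul_assoc]
  have h5 := ((hasSum_nat_add_iff (f := fun n => (q : ℍ[ℝ]) ^ n * mulLinearCoeff e a b n) 1).1
    h4).summable.hasSum
  have h6 : starMul f (regularLinear a b) q =
      ∑' n : ℕ, (q : ℍ[ℝ]) ^ n * mulLinearCoeff e a b n := by
    rw [starMul, hf.regularCoeff_eq, regularCoeff_linear]
    exact tsum_congr fun n => by rw [sum_mul_linearCoeff]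
  rw [h6]
  exact h5

theorem hasRegularExpansion_of_finite {f : unitBall → ℍ[ℝ]} (a : ℕ → ℍ[ℝ]) (N : ℕ)
    (ha : ∀ n, N ≤ n → a n = 0) (hf : ∀ q, f q = ∑ n ∈ Finset.range N, (q : ℍ[ℝ]) ^ n * a n) :
    HasRegularExpansion f a := by
  intro q
  rw [hf q]
  refine hasSum_sum_of_ne_finset_zero fun n hn => ?_
  rw [ha n (by simpa using hn), mul_zero]

/-- The symmetrization of `d - q d p`. -/
theorem symmetrization_linear (d p : ℍ[ℝ]) (q : unitBall) :
    symmetrization (regularLinear (-(d * p)) d) q =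
      Quaternion.normSq d • (1 - (2 * p.re) • (q : ℍ[ℝ]) +
        Quaternion.normSq p • (q : ℍ[ℝ]) ^ 2) := by
  have hd := Quaternion.self_mul_star d
  have hp := Quaternion.self_mul_star p
  have h := (hasRegularExpansion_linear (-(d * p)) d).starMul_linear
    (star (-(d * p))) (star d)
  rw [symmetrization, regularConj_linear]
  refine (h q).unique ?_
  refine hasRegularExpansion_of_finite (f := fun q : unitBall => Quaternion.normSq d •
    (1 - (2 * p.re) • (q : ℍ[ℝ]) + Quaternion.normSq p • (q : ℍ[ℝ]) ^ 2)) _ 3 ?_ ?_ q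
  · intro n hn
    obtain ⟨n, rfl⟩ := Nat.exists_eq_add_of_le' hn
    simp [mulLinearCoeff, linearCoeff]
  · intro q
    -- All three coefficients are real: p + p̄ and p p̄ are real, hence central, and can be pulled
    -- out from between d and d̄.
    have e0 : mulLinearCoeff (linearCoeff (-(d * p)) d) (star (-(d * p))) (star d) 0 =
        ((Quaternion.normSq d : ℝ) : ℍ[ℝ]) := by rw [← hd]; rfl
    have e1 : mulLinearCoeff (linearCoeff (-(d * p)) d) (star (-(d * p))) (star d) 1 =
        ((-(Quaternion.normSq d * (2 * p.re)) : ℝ) : ℍ[ℝ]) := by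
      have h1 : p + star p = ((2 * p.re : ℝ) : ℍ[ℝ]) := Quaternion.self_add_star' p
      have h2 : -(d * p) * star d + d * star (-(d * p)) = -(d * (p + star p) * star d) := by
        simp only [star_neg, star_mul]; noncomm_ring
      simp only [mulLinearCoeff, linearCoeff]
      simp only [zero_add, one_ne_zero, if_true, if_false]
      rw [h2, h1, ← Quaternion.coe_commutes, mul_assoc, hd]
      push_cast
      rw [← Quaternion.coe_commutes]
    have e2 : mulLinearCoeff (linearCoeff (-(d * p)) d) (star (-(d * p))) (star d) 2 =
        ((Quaternion.normSq d * Quaternion.normSq p : ℝ) : ℍ[ℝ]) := by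
      have h2 : -(d * p) * star (-(d * p)) = d * (p * star p) * star d := by
        simp only [star_neg, star_mul]; noncomm_ring
      simp only [mulLinearCoeff, linearCoeff]
      simp only [OfNat.ofNat_ne_zero, OfNat.ofNat_ne_one, one_ne_zero, if_true, if_false, zero_mul,
        zero_add, Nat.reduceAdd, h2, hp]
      rw [← Quaternion.coe_commutes, mul_assoc, hd]
      push_cast
      rw [← Quaternion.coe_commutes]
    rw [Finset.sum_range_succ, Finset.sum_range_succ, Finset.sum_range_one, e0, e1, e2]
    simp only [Quaternion.mul_coe_eq_smul, pow_zero, pow_one]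
    simp only [smul_add, smul_sub, smul_smul, neg_smul]
    abel

/-- The trace p + p̄ and the norm p p̄ are real, so p is a root of its real characteristic
quadratic. This is the recursion that makes the symmetrization annihilate ∑ qⁿ pⁿ up to its first
terms. -/
theorem Quaternion.sq_sub_add_normSq (p : ℍ[ℝ]) :
    p * p - (2 * p.re) • p + ((Quaternion.normSq p : ℝ) : ℍ[ℝ]) = 0 := by
  have h1 : p + star p = ((2 * p.re : ℝ) : ℍ[ℝ]) := Quaternion.self_add_star' p
  rw [← Quaternion.self_mul_star, ← Quaternion.coe_mul_eq_smul, Quaternion.coe_commutes, ← h1]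
  noncomm_ring

theorem summable_pow_mul_pow (q : unitBall) {p : ℍ[ℝ]} (hp : ‖p‖ < 1) (c : ℍ[ℝ]) :
    Summable fun n : ℕ => (q : ℍ[ℝ]) ^ n * (p ^ n * c) := by
  refine Summable.of_norm_bounded (g := fun n => ‖p‖ ^ n * ‖c‖)
    ((summable_geometric_of_lt_one (norm_nonneg p) hp).mul_right _) fun n => ?_
  rw [norm_mul, norm_mul, norm_pow, norm_pow]
  exact mul_le_of_le_one_left (by positivity)
    (pow_le_one₀ (norm_nonneg _) (norm_coe_unitBall_lt q).le)

/-- The regular reciprocal of `d - q d p` is `∑ qⁿ pⁿ d⁻¹`. -/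
theorem hasRegularExpansion_starInv_linear {d p : ℍ[ℝ]} (hd : d ≠ 0) (hp : ‖p‖ < 1) :
    HasRegularExpansion (starInv (regularLinear (-(d * p)) d)) (fun n => p ^ n * d⁻¹) := by
  intro q
  have hsum := (summable_pow_mul_pow q hp d⁻¹).hasSum
  set T := ∑' n : ℕ, (q : ℍ[ℝ]) ^ n * (p ^ n * d⁻¹) with hT
  have hD : Quaternion.normSq d ≠ 0 := Quaternion.normSq_ne_zero.2 hd
  have hdinv : Quaternion.normSq d • d⁻¹ = star d := by
    rw [← Quaternion.coe_mul_eq_smul, ← Quaternion.star_mul_self, mul_inv_cancel_right₀ hd]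
  -- The series T, -2 Re(p) q T and |p|² q² T, with 2, 1 and 0 initial terms removed, all have terms
  -- of degree n + 2. Their sum has terms qⁿ⁺² (p² - 2 Re(p) p + |p|²) pⁿ d⁻¹ = 0.
  have h2 := ((hasSum_nat_add_iff' 2).2 hsum)
  have h1 := (((hasSum_nat_add_iff' 1).2 hsum).mul_left (q : ℍ[ℝ])).const_smul (-(2 * p.re))
  have h0 := (hsum.mul_left ((q : ℍ[ℝ]) ^ 2)).const_smul (Quaternion.normSq p)
  have hz := (h2.add h1).add h0
  have hzero : (T - ∑ i ∈ Finset.range 2, (q : ℍ[ℝ]) ^ i * (p ^ i * d⁻¹)) +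
      -(2 * p.re) • (q * (T - ∑ i ∈ Finset.range 1, (q : ℍ[ℝ]) ^ i * (p ^ i * d⁻¹))) +
      Quaternion.normSq p • ((q : ℍ[ℝ]) ^ 2 * T) = 0 := by
    refine hz.unique ?_
    convert hasSum_zero using 2 with n
    have := Quaternion.sq_sub_add_normSq p
    have e : (q : ℍ[ℝ]) ^ (n + 2) * ((p * p - (2 * p.re) • p +
      ((Quaternion.normSq p : ℝ) : ℍ[ℝ])) * (p ^ n * d⁻¹)) = 0 := by rw [this]; simp
    rw [← e, add_mul, sub_mul, Quaternion.coe_mul_eq_smul]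
    simp only [pow_succ', mul_assoc, mul_add, mul_sub, neg_smul, smul_mul_assoc, mul_smul_comm,
      pow_zero, mul_one]
    abel
  -- Only the removed initial terms survive: (1 - 2 Re(p) q + |p|² q²) T = d⁻¹ - q p̄ d⁻¹. The
  -- factor |d|² turns d⁻¹ into d̄, which yields the regular conjugate.
  have hmul : symmetrization (regularLinear (-(d * p)) d) q * T =
      regularConj (regularLinear (-(d * p)) d) q := by
    rw [symmetrization_linear, regularConj_linear, regularLinear]
    have hT' : (1 - (2 * p.re) • (q : ℍ[ℝ]) + Quaternion.normSq p • (q : ℍ[ℝ]) ^ 2) * T =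
        d⁻¹ - q * (star p * d⁻¹) := by
      have h3 : star p = ((2 * p.re : ℝ) : ℍ[ℝ]) - p :=
        eq_sub_of_add_eq' (Quaternion.self_add_star' p)
      rw [h3, sub_mul, mul_sub, Quaternion.coe_mul_eq_smul]
      rw [← sub_eq_zero, ← hzero]
      simp only [Finset.sum_range_succ, Finset.sum_range_zero, pow_zero, pow_one, one_mul, zero_add,
        add_mul, sub_mul, smul_mul_assoc, mul_sub, smul_sub, neg_smul, mul_smul_comm]
      abel
    rw [smul_mul_assoc, hT', smul_sub, ← mul_smul_comm, ← mul_smul_comm, hdinv, star_neg, star_mul]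
    noncomm_ring
  -- A zero of f^s at q would by `hmul` be a zero of f^c, that is d̄ = q p̄ d̄. Taking norms
  -- excludes this, since |q| |p| < 1. Hence the convention 0⁻¹ = 0 plays no role in `starInv` here.
  have hne : symmetrization (regularLinear (-(d * p)) d) q ≠ 0 := by
    intro h0
    rw [h0, zero_mul, regularConj_linear, regularLinear, star_neg, star_mul] at hmul
    have h3 : star d = q * (star p * star d) := by
      rw [mul_neg, eq_comm, neg_add_eq_zero] at hmul
      exact hmul.symm
    have h4 := congrArg norm h3
    rw [norm_mul, norm_mul, norm_star, norm_star] at h4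
    have h5 : 0 < ‖d‖ := norm_pos_iff.2 hd
    have h6 : ‖(q : ℍ[ℝ])‖ * ‖p‖ < 1 :=
      mul_lt_one_of_nonneg_of_lt_one_left (norm_nonneg _) (norm_coe_unitBall_lt q) hp.le
    nlinarith
  have : starInv (regularLinear (-(d * p)) d) q = T := by
    rw [starInv, ← hmul, inv_mul_cancel_left₀ hne]
  rw [this]
  exact hsum

/-- The coefficients of the regular quotient `(d - q d p)^{-*} * (q a + b)`. -/
theorem hasRegularExpansion_quotient {d p : ℍ[ℝ]} (hd : d ≠ 0) (hp : ‖p‖ < 1) (a b : ℍ[ℝ]) :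
    HasRegularExpansion (starMul (starInv (regularLinear (-(d * p)) d)) (regularLinear a b))
      (fun n => Nat.casesOn n (d⁻¹ * b) fun n => p ^ n * (p * (d⁻¹ * b) + d⁻¹ * a)) := by
  convert (hasRegularExpansion_starInv_linear hd hp).starMul_linear a b using 1
  funext n
  rcases n with _ | n
  · simp [mulLinearCoeff]
  · simp only [mulLinearCoeff, pow_succ, mul_add, mul_assoc]

/-! ### Expansion and injectivity of φ -/

theorem star_mul_neg_mul_add (a u : ℍ[ℝ]) :
    star a * -(a * u) + u = (1 - Quaternion.normSq a) • u := by
  rw [mul_neg, ← mul_assoc, Quaternion.star_mul_self, Quaternion.coe_mul_eq_smul, sub_smul,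
    one_smul]
  abel

/-- This is the quotient expansion with d = 1, p = ā and numerator q u - a u; the factor 1 - |a|²
comes from ā(-a u) + u. -/
theorem hasRegularExpansion_mobiusParam (a : unitBall) (u : ℍ[ℝ]) :
    HasRegularExpansion (mobiusParam a u)
      (fun n => Nat.casesOn n (-(a * u)) fun n =>
        star (a : ℍ[ℝ]) ^ n * ((1 - Quaternion.normSq (a : ℍ[ℝ])) • u)) := by
  have h := hasRegularExpansion_quotient (d := 1) (p := star (a : ℍ[ℝ])) one_ne_zero
    (by rw [norm_star]; exact norm_coe_unitBall_lt a) u (-(a * u))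
  have e1 : regularLinear (-(1 * star (a : ℍ[ℝ]))) 1 =
      fun q : unitBall => 1 - (q : ℍ[ℝ]) * star (a : ℍ[ℝ]) := by
    funext q
    simp only [regularLinear, one_mul, mul_neg]
    abel
  have e2 : regularLinear u (-((a : ℍ[ℝ]) * u)) = fun q : unitBall => ((q : ℍ[ℝ]) - a) * u := by
    funext q
    rw [regularLinear, sub_mul, sub_eq_add_neg]
  rw [e1, e2] at h
  simp only [inv_one, one_mul, star_mul_neg_mul_add] at h
  exact h

theorem normSq_lt_one (a : unitBall) : Quaternion.normSq (a : ℍ[ℝ]) < 1 := by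
  rw [Quaternion.normSq_eq_norm_mul_self]
  exact mul_lt_one_of_nonneg_of_lt_one_left (norm_nonneg _) (norm_coe_unitBall_lt a)
    (norm_coe_unitBall_lt a).le

/-- Compare the first two coefficients. The norm of (1 - |a|²) u is the positive number 1 - |a|², so
this coefficient determines u; then -a u determines a. -/
theorem mobiusParam_injective {a b : unitBall} {u v : ℍ[ℝ]} (hu : ‖u‖ = 1) (hv : ‖v‖ = 1)
    (h : mobiusParam a u = mobiusParam b v) : a = b ∧ u = v := by
  have hb := hasRegularExpansion_mobiusParam b v
  rw [← h] at hb
  have key := (hasRegularExpansion_mobiusParam a u).unique hb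
  have h0 : -((a : ℍ[ℝ]) * u) = -(b * v) := congrFun key 0
  have h1 : (1 - Quaternion.normSq (a : ℍ[ℝ])) • u = (1 - Quaternion.normSq (b : ℍ[ℝ])) • v := by
    simpa using congrFun key 1
  have ha1 := normSq_lt_one a
  have hb1 := normSq_lt_one b
  have h2 := congrArg norm h1
  rw [norm_smul, norm_smul, hu, hv, Real.norm_of_nonneg (by linarith),
    Real.norm_of_nonneg (by linarith), mul_one, mul_one] at h2
  rw [h2] at h1
  have huv : u = v := smul_right_injective _ (by linarith : (1 - Quaternion.normSq (b : ℍ[ℝ])) ≠ 0) h1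
  have hv0 : v ≠ 0 := norm_ne_zero_iff.1 (by rw [hv]; exact one_ne_zero)
  rw [huv, neg_inj] at h0
  exact ⟨Subtype.ext (mul_right_cancel₀ hv0 h0), huv⟩

/-! ### Manifold structures along bijections, submersions and submanifolds -/

section Transport

variable {X Y H : Type*} [NormedAddCommGroup H] [NormedSpace ℝ H]
  [TopologicalSpace X] [ChartedSpace H X] [TopologicalSpace Y]

/-- The charts of `X` carried over to `Y` by a homeomorphism. -/
@[reducible]
def transportChartedSpace (H : Type*) [NormedAddCommGroup H] [NormedSpace ℝ H]
    [ChartedSpace H X] (f : X ≃ₜ Y) : ChartedSpace H Y where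
  atlas := f.symm.transOpenPartialHomeomorph '' atlas H X
  chartAt y := f.symm.transOpenPartialHomeomorph (chartAt H (f.symm y))
  mem_chart_source y := mem_chart_source H (f.symm y)
  chart_mem_atlas y := mem_image_of_mem _ (chart_mem_atlas H (f.symm y))

/-- The homeomorphism cancels in a change of charts, which is therefore one of `X`. -/
theorem transport_isManifold [IsManifold 𝓘(ℝ, H) ∞ X] (f : X ≃ₜ Y) :
    letI := transportChartedSpace H f
    IsManifold 𝓘(ℝ, H) ∞ Y := by
  let _ := transportChartedSpace H f
  refine { compatible := ?_ }
  rintro _ _ ⟨e, he, rfl⟩ ⟨e', he', rfl⟩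
  refine (contDiffGroupoid ∞ 𝓘(ℝ, H)).mem_of_eqOnSource
    ((contDiffGroupoid ∞ 𝓘(ℝ, H)).compatible he he') ⟨?_, fun x _ => ?_⟩
  · ext x
    simp
  · simp

theorem transport_contMDiff [IsManifold 𝓘(ℝ, H) ∞ X] (f : X ≃ₜ Y) :
    letI := transportChartedSpace H f
    ContMDiff 𝓘(ℝ, H) 𝓘(ℝ, H) ∞ f ∧ ContMDiff 𝓘(ℝ, H) 𝓘(ℝ, H) ∞ f.symm := by
  let _ := transportChartedSpace H f
  have := transport_isManifold (H := H) f
  constructor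
  · intro x
    have hx : f x ∈ (chartAt H (f x)).source := mem_chart_source H (f x)
    have h1 := contMDiffAt_symm_of_mem_maximalAtlas (I := 𝓘(ℝ, H)) (n := ∞)
      (IsManifold.chart_mem_maximalAtlas (f x)) ((chartAt H (f x)).map_source hx)
    have hy : x ∈ (chartAt H (f.symm (f x))).source := by
      simp
    have h2 := contMDiffAt_of_mem_maximalAtlas (I := 𝓘(ℝ, H)) (n := ∞)
      (IsManifold.chart_mem_maximalAtlas (f.symm (f x))) hy
    -- The chart at `f x` is built on the chart of `X` at `f.symm (f x)`, so in these charts `f` is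
    -- the identity.
    have e : chartAt H (f x) (f x) = chartAt H (f.symm (f x)) x :=
      congrArg (chartAt H (f.symm (f x))) (f.symm_apply_apply x)
    rw [e] at h1
    refine (h1.comp x h2).congr_of_eventuallyEq ?_
    filter_upwards [(chartAt H (f.symm (f x))).open_source.mem_nhds hy] with z hz
    exact congrArg f ((chartAt H (f.symm (f x))).left_inv hz).symm
  · intro y
    have h1 := contMDiffAt_symm_of_mem_maximalAtlas (I := 𝓘(ℝ, H)) (n := ∞)
      (IsManifold.chart_mem_maximalAtlas (f.symm y))
      ((chartAt H (f.symm y)).map_source (mem_chart_source H (f.symm y)))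
    have h2 := contMDiffAt_of_mem_maximalAtlas (I := 𝓘(ℝ, H)) (n := ∞)
      (IsManifold.chart_mem_maximalAtlas y) (mem_chart_source H y)
    refine (ContMDiffAt.comp y h1 h2).congr_of_eventuallyEq ?_
    filter_upwards [(chartAt H y).open_source.mem_nhds (mem_chart_source H y)] with z hz
    exact ((chartAt H (f.symm y)).left_inv hz).symm

/-- The diffeomorphism from `X` to `Y` with the manifold structure of `X` carried over. -/
def transportDiffeomorph [IsManifold 𝓘(ℝ, H) ∞ X] (f : X ≃ₜ Y) :
    letI := transportChartedSpace H f
    X ≃ₘ⟮𝓘(ℝ, H), 𝓘(ℝ, H)⟯ Y :=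
  letI := transportChartedSpace H f
  { toEquiv := f.toEquiv
    contMDiff_toFun := (transport_contMDiff f).1
    contMDiff_invFun := (transport_contMDiff f).2 }

end Transport

section Smoothness

variable {E F H K : Type*} [NormedAddCommGroup E] [NormedSpace ℝ E]
  [NormedAddCommGroup F] [NormedSpace ℝ F] [NormedAddCommGroup H] [NormedSpace ℝ H]
  [NormedAddCommGroup K] [NormedSpace ℝ K] {K' : Type*} [TopologicalSpace K']
  {J : ModelWithCorners ℝ K K'} {N : Type*} [TopologicalSpace N] [ChartedSpace K' N]

/-- A map from a manifold to a submanifold of `E` is smooth if it is smooth as a map into `E`. -/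
theorem submanifold_contMDiff_of_coe (S : Set E)
    (h : ∀ x : S, ∃ e ∈ submanifoldAtlas S H, x ∈ e.source)
    {σ : N → S} (hσ : ContMDiff J 𝓘(ℝ, E) ∞ (fun x => (σ x : E))) :
    letI := submanifoldChartedSpace S h
    ContMDiff J 𝓘(ℝ, H) ∞ σ := by
  let _ := submanifoldChartedSpace S h
  have := submanifold_isManifold S h
  intro x
  have hcont : ContinuousAt σ x :=
    (Topology.IsInducing.subtypeVal.continuousAt_iff).2 (hσ x).continuousAt
  set e := chartAt H (σ x) with he
  have hm : e ∈ IsManifold.maximalAtlas 𝓘(ℝ, H) ∞ S := IsManifold.chart_mem_maximalAtlas _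
  have hx' : σ x ∈ e.source := mem_chart_source H _
  -- Near `σ x` the chart is the restriction of a smooth map on an open set of the ambient space, so
  -- its composite with `σ` is smooth.
  obtain ⟨V, f, hV, hxV, hf, hef⟩ := (h (σ x)).choose_spec.1.2 (σ x) hx'
  have h2 : ContMDiffAt J 𝓘(ℝ, H) ∞ (fun y => f (σ y : E)) x :=
    ContMDiffAt.comp x ((hf _ hxV).contDiffAt (hV.mem_nhds hxV)).contMDiffAt (hσ x)
  have c1 : ∀ᶠ y in 𝓝 x, σ y ∈ e.source := hcont.eventually (e.open_source.mem_nhds hx')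
  have c2 : ∀ᶠ y in 𝓝 x, (σ y : E) ∈ V :=
    (hσ x).continuousAt.eventually (hV.mem_nhds hxV)
  have h3 : ContMDiffAt J 𝓘(ℝ, H) ∞ (fun y => e (σ y)) x := by
    refine h2.congr_of_eventuallyEq ?_
    filter_upwards [c1, c2] with y hy1 hy2
    exact hef _ hy1 hy2
  have h4 := contMDiffAt_symm_of_mem_maximalAtlas hm (e.map_source hx')
  refine (ContMDiffAt.comp x h4 h3).congr_of_eventuallyEq ?_
  filter_upwards [c1] with y hy1
  simp [e.left_inv hy1]

theorem submanifold_contMDiff_of_contDiff_comp (S : Set E)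
    (h : ∀ x : S, ∃ e ∈ submanifoldAtlas S H, x ∈ e.source) {σ : N → S} {f : F → E} {g : N → F}
    (hf : ContDiff ℝ ∞ f) (hg : ContMDiff J 𝓘(ℝ, F) ∞ g) (hσ : ∀ x, (σ x : E) = f (g x)) :
    letI := submanifoldChartedSpace S h
    ContMDiff J 𝓘(ℝ, H) ∞ σ :=
  submanifold_contMDiff_of_coe S h ((hf.contMDiff.comp hg).congr hσ)

/-- A map of a submanifold to itself that extends to a smooth map of `E` is smooth. -/
theorem submanifold_contMDiff_self (S : Set E)
    (h : ∀ x : S, ∃ e ∈ submanifoldAtlas S H, x ∈ e.source) {σ : S → S} {f : E → E}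
    (hf : ContDiff ℝ ∞ f) (hσ : ∀ x, (σ x : E) = f x) :
    letI := submanifoldChartedSpace S h
    ContMDiff 𝓘(ℝ, H) 𝓘(ℝ, H) ∞ σ := by
  let _ := submanifoldChartedSpace S h
  exact submanifold_contMDiff_of_contDiff_comp S h hf (submanifold_contMDiff_coe S h) hσ

variable {P X : Type*} [TopologicalSpace P] [ChartedSpace F P] [TopologicalSpace X]

/-- The projection onto the base of a submersion is smooth. -/
theorem quotient_contMDiff_proj (π : P → X) (hπ : Continuous π)
    (h : ∀ x : X, ∃ e ∈ quotientAtlas F H π, x ∈ e.source) :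
    letI := quotientChartedSpace π h
    ContMDiff 𝓘(ℝ, F) 𝓘(ℝ, H) ∞ π := by
  let _ := quotientChartedSpace π h
  have := quotient_isManifold π hπ h
  intro p
  have hm : chartAt H (π p) ∈ IsManifold.maximalAtlas 𝓘(ℝ, H) ∞ X :=
    IsManifold.chart_mem_maximalAtlas _
  have hx : π p ∈ (chartAt H (π p)).source := mem_chart_source H _
  have ho := ((chartAt H (π p)).open_source.preimage hπ).mem_nhds hx
  have h1 : ContMDiffAt 𝓘(ℝ, F) 𝓘(ℝ, H) ∞ (chartAt H (π p) ∘ π) p :=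
    ((h (π p)).choose_spec.1.1 p hx).contMDiffAt ho
  have h2 := contMDiffAt_symm_of_mem_maximalAtlas hm ((chartAt H (π p)).map_source hx)
  refine (ContMDiffAt.comp p h2 h1).congr_of_eventuallyEq ?_
  filter_upwards [ho] with y hy
  exact ((chartAt H (π p)).left_inv hy).symm

/-- A map on the base of a submersion `π` is smooth if its composition with `π` is. -/
theorem quotient_contMDiff_of_comp (π : P → X) (hπ : Continuous π)
    (h : ∀ x : X, ∃ e ∈ quotientAtlas F H π, x ∈ e.source) {g : X → N}
    (hg : ContMDiff 𝓘(ℝ, F) J ∞ (g ∘ π)) :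
    letI := quotientChartedSpace π h
    ContMDiff 𝓘(ℝ, H) J ∞ g := by
  let _ := quotientChartedSpace π h
  have := quotient_isManifold π hπ h
  intro x
  have hx : x ∈ (chartAt H x).source := mem_chart_source H x
  have hm : chartAt H x ∈ IsManifold.maximalAtlas 𝓘(ℝ, H) ∞ X :=
    IsManifold.chart_mem_maximalAtlas _
  -- A smooth local lift `σ` of the inverse chart gives g = (g ∘ π) ∘ σ ∘ chart near x.
  obtain ⟨U, σ, hU, hxU, -, hσ, hσe⟩ :=
    (h x).choose_spec.1.2 _ ((chartAt H x).map_source hx)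
  have h1 : ContMDiffAt 𝓘(ℝ, H) 𝓘(ℝ, F) ∞ σ (chartAt H x x) :=
    (hσ _ hxU).contMDiffAt (hU.mem_nhds hxU)
  have h2 := contMDiffAt_of_mem_maximalAtlas hm hx
  have h3 := ContMDiffAt.comp x ((hg _).comp _ h1) h2
  refine h3.congr_of_eventuallyEq ?_
  filter_upwards [(chartAt H x).open_source.mem_nhds hx,
    h2.continuousAt.eventually (hU.mem_nhds hxU)] with z hz hz'
  exact congrArg g (((hσe _ hz').trans ((chartAt H x).left_inv hz)).symm)

end Smoothness

/-! ### The diffeomorphism from `Sp(1,1) / Sp(1) I₂` to `ℍ × Sp(1)` -/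

/-- The rows satisfy the same relations as the columns, because A I₁₁ A* = I₁₁ as well. Together
with |d|² = 1 + |c|² this gives |b| = |c|. -/
theorem SpOneOne.rows (A : SpOneOne) :
    A.1 0 0 * star (A.1 1 0) = A.1 0 1 * star (A.1 1 1) ∧
      Quaternion.normSq (A.1 1 0) = Quaternion.normSq (A.1 0 1) := by
  have h := SpOneOne.conj_mul A.2
  have h01 := congr_fun (congr_fun h 0) 1
  have h11 := congr_fun (congr_fun h 1) 1
  simp [signatureMatrix, Matrix.mul_apply, Fin.sum_univ_two, Quaternion.self_mul_star] at h01 h11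
  refine ⟨by rwa [add_neg_eq_zero] at h01, ?_⟩
  have h1 := congrArg QuaternionAlgebra.re h11
  have h2 := (SpOneOne.rel A.2).1
  simp at h1
  linarith

theorem SpOneOne.normSq_eq_rad_sq (A : SpOneOne) :
    Quaternion.normSq (A.1 1 1) = rad (A.1 0 1) * rad (A.1 0 1) ∧
      Quaternion.normSq (A.1 0 0) = rad (A.1 0 1) * rad (A.1 0 1) := by
  rw [rad_sq]
  exact ⟨(SpOneOne.rel A.2).1, (SpOneOne.rel A.2).2.1⟩

theorem SpOneOne.lower_right_ne_zero (A : SpOneOne) : A.1 1 1 ≠ 0 := by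
  rw [← Quaternion.normSq_ne_zero, (SpOneOne.normSq_eq_rad_sq A).1]
  exact mul_ne_zero (rad_pos _).ne' (rad_pos _).ne'

/-- On Sp(1,1) one has |d| = √(1 + |c|²), so d⁻¹ = d̄ / (1 + |c|²). The right side makes sense and
is smooth on all matrices, which is why the coordinates below are written with `rad`. -/
theorem SpOneOne.mul_inv_lower_right (A : SpOneOne) (x : ℍ[ℝ]) :
    x * (A.1 1 1)⁻¹ =
      ((rad (A.1 0 1))⁻¹ * (rad (A.1 0 1))⁻¹) • (x * star (A.1 1 1)) := by
  have hr := (rad_pos (A.1 0 1)).ne'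
  rw [mul_inv_eq_iff_eq_mul₀ (SpOneOne.lower_right_ne_zero A), smul_mul_assoc, mul_assoc,
    Quaternion.star_mul_self, (SpOneOne.normSq_eq_rad_sq A).1, Quaternion.mul_coe_eq_smul, smul_smul]
  rw [show (rad (A.1 0 1))⁻¹ * (rad (A.1 0 1))⁻¹ * (rad (A.1 0 1) * rad (A.1 0 1)) = 1 by
    field_simp, one_smul]

/-- The unit quaternion `conj (a d⁻¹)` of a matrix with rows `(a, c)` and `(b, d)`. -/
def sphereCoord (A : Matrix (Fin 2) (Fin 2) ℍ[ℝ]) : ℍ[ℝ] :=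
  star (((rad (A 0 1))⁻¹ * (rad (A 0 1))⁻¹) • (A 0 0 * star (A 1 1)))

/-- The quaternion `b conj d / |d|` of a matrix with rows `(a, c)` and `(b, d)`. -/
def vectorCoord (A : Matrix (Fin 2) (Fin 2) ℍ[ℝ]) : ℍ[ℝ] :=
  (rad (A 0 1))⁻¹ • (A 1 0 * star (A 1 1))

theorem contDiff_sphereCoord : ContDiff ℝ ∞ sphereCoord :=
  contDiff_quaternion_star.comp contDiff_norm_first

theorem contDiff_vectorCoord : ContDiff ℝ ∞ vectorCoord :=
  contDiff_inv_rad.smul ((contDiff_entry 1 0).mul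
    (contDiff_quaternion_star.comp (contDiff_entry 1 1)))

theorem norm_eq_one_of_normSq {u : ℍ[ℝ]} (h : Quaternion.normSq u = 1) : ‖u‖ = 1 := by
  rw [Quaternion.normSq_eq_norm_mul_self] at h
  nlinarith [norm_nonneg u]

theorem normSq_eq_one_of_norm {u : ℍ[ℝ]} (h : ‖u‖ = 1) : Quaternion.normSq u = 1 := by
  rw [Quaternion.normSq_eq_norm_mul_self, h, one_mul]

theorem sphereCoord_mem (A : SpOneOne) : sphereCoord A.1 ∈ Metric.sphere (0 : ℍ[ℝ]) 1 := by
  have hr := (rad_pos (A.1 0 1)).ne'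
  rw [mem_sphere_zero_iff_norm]
  refine norm_eq_one_of_normSq ?_
  rw [sphereCoord, Quaternion.normSq_star, Quaternion.normSq_smul, map_mul, Quaternion.normSq_star,
    (SpOneOne.normSq_eq_rad_sq A).1, (SpOneOne.normSq_eq_rad_sq A).2]
  field_simp

theorem normSq_vectorCoord (A : SpOneOne) :
    Quaternion.normSq (vectorCoord A.1) = Quaternion.normSq (A.1 0 1) := by
  have hr := (rad_pos (A.1 0 1)).ne'
  rw [vectorCoord, Quaternion.normSq_smul, map_mul, Quaternion.normSq_star,
    (SpOneOne.normSq_eq_rad_sq A).1, (SpOneOne.rows A).2]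
  field_simp

/-- The coordinates `(b conj d / |d|, conj (a d⁻¹))` on `Sp(1,1)`. -/
def SpOneOne.polar (A : SpOneOne) : ℍ[ℝ] × Metric.sphere (0 : ℍ[ℝ]) 1 :=
  (vectorCoord A.1, ⟨sphereCoord A.1, sphereCoord_mem A⟩)

/-- A global section of `Sp(1,1) → Sp(1,1) / Sp(1) I₂`. -/
def SpOneOne.polarSection (y : ℍ[ℝ] × Metric.sphere (0 : ℍ[ℝ]) 1) : SpOneOne :=
  SpOneOne.build (star (y.2 : ℍ[ℝ]) * star y.1) (star (y.2 : ℍ[ℝ])) 1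
    (by rw [Quaternion.normSq_star]; exact normSq_eq_one_of_norm (norm_eq_of_mem_sphere y.2))
    (by simp)

theorem SpOneOne.polar_polarSection (y : ℍ[ℝ] × Metric.sphere (0 : ℍ[ℝ]) 1) :
    SpOneOne.polar (SpOneOne.polarSection y) = y := by
  obtain ⟨x, u, hu⟩ := y
  have hn := normSq_eq_one_of_norm (mem_sphere_zero_iff_norm.1 hu)
  have hus : u * star u = 1 := by rw [Quaternion.self_mul_star, hn]; rfl
  have hr := (rad_pos (star u * star x)).ne'
  refine Prod.ext ?_ (Subtype.ext ?_)
  · change (rad (star u * star x))⁻¹ • ((1 * star (star u * star x) * star u) *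
      star (rad (star u * star x) • (1 : ℍ[ℝ]))) = x
    rw [Quaternion.star_smul, star_one, mul_smul_comm, smul_smul, inv_mul_cancel₀ hr, one_smul,
      star_mul, star_star, star_star, one_mul, mul_one, mul_assoc, hus, mul_one]
  · change star (((rad (star u * star x))⁻¹ * (rad (star u * star x))⁻¹) •
      ((rad (star u * star x) • star u) * star (rad (star u * star x) • (1 : ℍ[ℝ])))) = u
    rw [Quaternion.star_smul (rad (star u * star x)) (1 : ℍ[ℝ]), star_one, mul_smul_comm, smul_smul,
      mul_one, smul_smul]
    rw [show (rad (star u * star x))⁻¹ * (rad (star u * star x))⁻¹ * rad (star u * star x) *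
      rad (star u * star x) = 1 by field_simp, one_smul, star_star]

/-- Right multiplication by a unit u inserts u ū = 1 into the products a d̄ and b d̄ and keeps |c|.
-/
theorem SpOneOne.polar_eq {A B : SpOneOne} (h : SpOneOne.proj A = SpOneOne.proj B) :
    SpOneOne.polar A = SpOneOne.polar B := by
  obtain ⟨u, hu, hB⟩ := SpOneOne.proj_rel h
  obtain ⟨h1, -, h3⟩ := SpOneOne.q_invariant hu hB
  have hu' : u * star u = 1 := by
    rw [Quaternion.self_mul_star, normSq_eq_one_of_norm hu]; rfl
  have h2 : B.1 1 0 * star (B.1 1 1) = A.1 1 0 * star (A.1 1 1) := by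
    rw [hB, hB, star_mul, mul_assoc, ← mul_assoc u, hu', one_mul]
  simp only [SpOneOne.polar, vectorCoord, sphereCoord, h1, h2, h3]

theorem exists_spOneScalar {u : ℍ[ℝ]} (hu : ‖u‖ = 1) :
    ∃ k ∈ spOneScalar, k.1 = Matrix.diagonal fun _ => u := by
  have hus : star u * u = 1 := by
    rw [Quaternion.star_mul_self, normSq_eq_one_of_norm hu]; rfl
  have hkm : (Matrix.diagonal fun _ => u : Matrix (Fin 2) (Fin 2) ℍ[ℝ]) ∈ SpOneOne := by
    change _ * _ * _ = _
    rw [Matrix.diagonal_conjTranspose, mul_assoc]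
    ext1 i j
    fin_cases i <;> fin_cases j <;> simp [signatureMatrix, hus]
  exact ⟨⟨_, hkm⟩, ⟨u, hu, rfl⟩, rfl⟩

/-- Multiplying `A` on the right by the unit scalar d̄ / |d| makes the lower right entry equal to r
= |d|. The other entries are then functions of the polar coordinates; for the upper right one this
is the row relation a b̄ = c d̄. -/
theorem SpOneOne.proj_polarSection_polar (A : SpOneOne) :
    SpOneOne.proj (SpOneOne.polarSection (SpOneOne.polar A)) = SpOneOne.proj A := by
  have hr := (rad_pos (A.1 0 1)).ne'
  set r := rad (A.1 0 1) with hrdef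
  have hd : Quaternion.normSq (A.1 1 1) = r * r := (SpOneOne.normSq_eq_rad_sq A).1
  have hu : ‖r⁻¹ • star (A.1 1 1)‖ = 1 := by
    refine norm_eq_one_of_normSq ?_
    rw [Quaternion.normSq_smul, Quaternion.normSq_star, hd]
    field_simp
  obtain ⟨k, hkK, hk⟩ := exists_spOneScalar hu
  have hAk : ∀ i j, (A * k).1 i j = A.1 i j * (r⁻¹ • star (A.1 1 1)) := SpOneOne.mul_scalar hk A
  have hc : star (sphereCoord A.1) * star (vectorCoord A.1) = (A * k).1 0 1 := by
    rw [hAk, sphereCoord, star_star, vectorCoord, Quaternion.star_smul, star_mul, star_star,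
      smul_mul_smul_comm, ← hrdef]
    have h : A.1 0 0 * star (A.1 1 1) * (A.1 1 1 * star (A.1 1 0)) =
        (r * r) • (A.1 0 1 * star (A.1 1 1)) := by
      rw [mul_assoc, ← mul_assoc (star _), Quaternion.star_mul_self, hd,
        Quaternion.coe_mul_eq_smul, mul_smul_comm, (SpOneOne.rows A).1]
    rw [h, smul_smul, mul_smul_comm]
    congr 1
    field_simp
  have hrad : rad (star (sphereCoord A.1) * star (vectorCoord A.1)) = r := by
    rw [hc]
    exact (SpOneOne.q_invariant hu hAk).1
  have key : SpOneOne.polarSection (SpOneOne.polar A) = A * k := by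
    refine SpOneOne.ext' ?_ ?_ ?_
    · change rad (star (sphereCoord A.1) * star (vectorCoord A.1)) • star (sphereCoord A.1) = _
      rw [hrad, hAk, sphereCoord, star_star, ← hrdef, smul_smul, mul_smul_comm]
      congr 1
      field_simp
    · exact hc
    · change rad (star (sphereCoord A.1) * star (vectorCoord A.1)) • (1 : ℍ[ℝ]) = _
      rw [hrad, hAk, mul_smul_comm, Quaternion.self_mul_star, hd, ← Quaternion.coe_smul, smul_eq_mul,
        inv_mul_cancel_left₀ hr, ← Quaternion.coe_one, ← Quaternion.coe_smul, smul_eq_mul, mul_one]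
  rw [key]
  exact (QuotientGroup.eq.2 (by simpa using hkK)).symm

/-! ### Smoothness of the polar coordinates, and the submersion property -/

theorem SpOneOne.contMDiff_comp_coe {F : Type*} [NormedAddCommGroup F] [NormedSpace ℝ F]
    {f : Matrix (Fin 2) (Fin 2) ℍ[ℝ] → F} (hf : ContDiff ℝ ∞ f) :
    ContMDiff (𝓡 10) 𝓘(ℝ, F) ∞ (fun A : SpOneOne => f A.1) :=
  contMDiffOn_univ.1 ((SpOneOne.contMDiffOn_restrict (U := univ) hf.contDiffOn).mono fun _ _ => mem_univ _)

theorem SpOneOne.contMDiff_proj : ContMDiff (𝓡 10) (𝓡 7) ∞ SpOneOne.proj :=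
  quotient_contMDiff_proj SpOneOne.proj continuous_quotient_mk' SpOneOne.exists_qchart

theorem SpOneOne.contMDiff_mul_right (k : SpOneOne) :
    ContMDiff (𝓡 10) (𝓡 10) ∞ (fun A : SpOneOne => A * k) := by
  have h : ContDiff ℝ ∞ (fun A : Matrix (Fin 2) (Fin 2) ℍ[ℝ] => A * k.1) :=
    (LinearMap.mulRight ℝ k.1).toContinuousLinearMap.contDiff
  exact submanifold_contMDiff_self SpOneOne SpOneOne.exists_chart h fun _ => rfl

theorem SpOneOne.contMDiff_polar :
    ContMDiff (𝓡 10) (𝓘(ℝ, ℍ[ℝ]).prod (𝓡 3)) ∞ SpOneOne.polar := by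
  refine ContMDiff.prodMk ?_ ?_
  · exact SpOneOne.contMDiff_comp_coe contDiff_vectorCoord
  · exact (SpOneOne.contMDiff_comp_coe contDiff_sphereCoord).codRestrict_sphere
      sphereCoord_mem

theorem SpOneOne.contMDiff_polarSection :
    ContMDiff (𝓘(ℝ, ℍ[ℝ]).prod (𝓡 3)) (𝓡 10) ∞ SpOneOne.polarSection := by
  -- The matrix entries of the section extend smoothly from ℍ × Sp(1) to ℍ × ℍ, where membership in
  -- Sp(1,1) is lost but not needed.
  have h : ContDiff ℝ ∞ (fun y : ℍ[ℝ] × ℍ[ℝ] =>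
      !![rad (star y.2 * star y.1) • star y.2, star y.2 * star y.1;
        1 * star (star y.2 * star y.1) * star y.2, rad (star y.2 * star y.1) • (1 : ℍ[ℝ])]) := by
    have h1 : ContDiff ℝ ∞ (fun y : ℍ[ℝ] × ℍ[ℝ] => star y.2) :=
      contDiff_quaternion_star.comp contDiff_snd
    have h2 : ContDiff ℝ ∞ (fun y : ℍ[ℝ] × ℍ[ℝ] => star y.2 * star y.1) :=
      h1.mul (contDiff_quaternion_star.comp contDiff_fst)
    have h3 : ContDiff ℝ ∞ (fun y : ℍ[ℝ] × ℍ[ℝ] => rad (star y.2 * star y.1)) :=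
      contDiff_rad.comp h2
    refine contDiff_matrix fun i j => ?_
    fin_cases i <;> fin_cases j
    · exact h3.smul h1
    · exact h2
    · exact (contDiff_const.mul (contDiff_quaternion_star.comp h2)).mul h1
    · exact h3.smul contDiff_const
  have h4 : ContMDiff (𝓘(ℝ, ℍ[ℝ]).prod (𝓡 3)) 𝓘(ℝ, ℍ[ℝ] × ℍ[ℝ]) ∞
      (fun y : ℍ[ℝ] × Metric.sphere (0 : ℍ[ℝ]) 1 => (y.1, (y.2 : ℍ[ℝ]))) :=
    contMDiff_fst.prodMk_space (contMDiff_coe_sphere.comp contMDiff_snd)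
  exact submanifold_contMDiff_of_contDiff_comp SpOneOne SpOneOne.exists_chart h h4 fun _ => rfl

/-- The diffeomorphism from `Sp(1,1) / Sp(1) I₂` to `ℍ × Sp(1)`. -/
def SpOneOne.polarDiffeomorph :
    (SpOneOne ⧸ spOneScalar) ≃ₘ⟮𝓡 7, 𝓘(ℝ, ℍ[ℝ]).prod (𝓡 3)⟯
      (ℍ[ℝ] × Metric.sphere (0 : ℍ[ℝ]) 1) where
  toFun x := SpOneOne.polar x.out
  invFun y := SpOneOne.proj (SpOneOne.polarSection y)
  left_inv x := (SpOneOne.proj_polarSection_polar x.out).trans (QuotientGroup.out_eq' x)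
  right_inv y := (SpOneOne.polar_eq (QuotientGroup.out_eq' _)).trans
    (SpOneOne.polar_polarSection y)
  contMDiff_toFun := by
    refine quotient_contMDiff_of_comp SpOneOne.proj continuous_quotient_mk'
      SpOneOne.exists_qchart ?_
    refine SpOneOne.contMDiff_polar.congr fun A => ?_
    exact SpOneOne.polar_eq (QuotientGroup.out_eq' (SpOneOne.proj A))
  contMDiff_invFun := SpOneOne.contMDiff_proj.comp SpOneOne.contMDiff_polarSection

theorem SpOneOne.polarDiffeomorph_proj (A : SpOneOne) :
    SpOneOne.polarDiffeomorph (SpOneOne.proj A) = SpOneOne.polar A :=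
  SpOneOne.polar_eq (QuotientGroup.out_eq' (SpOneOne.proj A))

theorem SpOneOne.proj_mul {A B k : SpOneOne} (hk : k ∈ spOneScalar)
    (h : SpOneOne.proj A = SpOneOne.proj B) : SpOneOne.proj (A * k) = SpOneOne.proj B := by
  rw [← h]
  exact (QuotientGroup.eq.2 (by simpa using hk)).symm

/-- The global section, translated on the right by the scalar k that moves its value on the coset of
`A` to `A` itself, is a smooth section through `A`. By the chain rule its derivative is a right
inverse of that of the projection. -/
theorem SpOneOne.surjective_mfderiv_proj (A : SpOneOne) :
    Function.Surjective (mfderiv (𝓡 10) (𝓡 7) SpOneOne.proj A) := by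
  set k : SpOneOne := (SpOneOne.polarSection (SpOneOne.polar A))⁻¹ * A with hk
  have hkK : k ∈ spOneScalar := QuotientGroup.eq.1 (SpOneOne.proj_polarSection_polar A)
  let σ : SpOneOne ⧸ spOneScalar → SpOneOne :=
    fun x => SpOneOne.polarSection (SpOneOne.polarDiffeomorph x) * k
  have hσ : ContMDiff (𝓡 7) (𝓡 10) ∞ σ :=
    (SpOneOne.contMDiff_mul_right k).comp
      (SpOneOne.contMDiff_polarSection.comp SpOneOne.polarDiffeomorph.contMDiff)
  have hσA : σ (SpOneOne.proj A) = A := by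
    change SpOneOne.polarSection (SpOneOne.polarDiffeomorph (SpOneOne.proj A)) * k = A
    rw [SpOneOne.polarDiffeomorph_proj, hk, mul_inv_cancel_left]
  have hid : SpOneOne.proj ∘ σ = id := by
    funext x
    obtain ⟨B, rfl⟩ := QuotientGroup.mk_surjective x
    refine SpOneOne.proj_mul hkK ?_
    exact (congrArg _ (congrArg _ (SpOneOne.polarDiffeomorph_proj B))).trans
      (SpOneOne.proj_polarSection_polar B)
  have h1 : MDifferentiableAt (𝓡 10) (𝓡 7) SpOneOne.proj (σ (SpOneOne.proj A)) :=
    (SpOneOne.contMDiff_proj _).mdifferentiableAt (by simp)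
  have h2 : MDifferentiableAt (𝓡 7) (𝓡 10) σ (SpOneOne.proj A) :=
    (hσ _).mdifferentiableAt (by simp)
  have h3 := mfderiv_comp (SpOneOne.proj A) h1 h2
  rw [hid, mfderiv_id, hσA] at h3
  intro v
  exact ⟨mfderiv (𝓡 7) (𝓡 10) σ (SpOneOne.proj A) v, (DFunLike.congr_fun h3 v).symm⟩

/-! ### The unit ball and the regular Möbius transformations -/

/-- The diffeomorphism `a ↦ a / √(1 - |a|²)` from the unit ball to `ℍ`. -/
def unitBallDiffeomorph : unitBall ≃ₘ⟮𝓘(ℝ, ℍ[ℝ]), 𝓘(ℝ, ℍ[ℝ])⟯ ℍ[ℝ] where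
  toFun a := OpenPartialHomeomorph.univUnitBall.symm a
  invFun x := ⟨OpenPartialHomeomorph.univUnitBall x,
    OpenPartialHomeomorph.univUnitBall.map_source (mem_univ x)⟩
  left_inv a := Subtype.ext (OpenPartialHomeomorph.univUnitBall.right_inv a.2)
  right_inv x := OpenPartialHomeomorph.univUnitBall.left_inv (mem_univ x)
  contMDiff_toFun := contMDiffOn_univ.1
    ((OpenPartialHomeomorph.contDiffOn_univUnitBall_symm (n := ⊤)).contMDiffOn.comp
      contMDiff_subtype_val.contMDiffOn fun a _ => a.2)
  contMDiff_invFun := (ContMDiff.subtypeVal_comp_iff unitBall _).1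
    (OpenPartialHomeomorph.contDiff_univUnitBall (n := ⊤)).contMDiff

/-- A nonzero constant left factor cancels in a regular quotient, as the coefficients show. This is
also why 𝓕_{A⁻¹}, and not 𝓕_A, depends only on the left coset of `A`. -/
theorem regularQuotient_eq_mobiusParam {d : ℍ[ℝ]} (hd : d ≠ 0) (a : unitBall) (u : ℍ[ℝ]) :
    starMul (starInv (regularLinear (-(d * star (a : ℍ[ℝ]))) d))
      (regularLinear (d * u) (-(d * (a * u)))) = mobiusParam a u := by
  refine HasRegularExpansion.eq ?_ (hasRegularExpansion_mobiusParam a u)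
  convert hasRegularExpansion_quotient hd
    (by rw [norm_star]; exact norm_coe_unitBall_lt a) (d * u) (-(d * (a * u))) using 1
  simp only [mul_neg, inv_mul_cancel_left₀ hd, ← star_mul_neg_mul_add]

theorem coe_unitBallDiffeomorph_symm_polar (A : SpOneOne) :
    (unitBallDiffeomorph.symm (SpOneOne.polar A).1 : ℍ[ℝ]) = A.1 1 0 * (A.1 1 1)⁻¹ := by
  have h : √(1 + ‖vectorCoord A.1‖ ^ 2) = rad (A.1 0 1) := by
    rw [rad, sq, ← Quaternion.normSq_eq_norm_mul_self, normSq_vectorCoord]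
  -- The inverse diffeomorphism is x ↦ x / √(1 + |x|²), and the root is |d| because |x| = |c|.
  change (√(1 + ‖vectorCoord A.1‖ ^ 2))⁻¹ • vectorCoord A.1 = _
  rw [h, SpOneOne.mul_inv_lower_right, vectorCoord, smul_smul]

/-- Factor d̄ out on the left of both parts of (d̄ - q b̄)^{-*} * (q ā - c̄). -/
theorem regularMobius_inv (A : SpOneOne) :
    regularMobius (A⁻¹ : SpOneOne).1 =
      mobiusParam (unitBallDiffeomorph.symm (SpOneOne.polar A).1) (SpOneOne.polar A).2 := by
  have hd := SpOneOne.lower_right_ne_zero A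
  have hd' : star (A.1 1 1) ≠ 0 := star_ne_zero.2 hd
  have ha := coe_unitBallDiffeomorph_symm_polar A
  have hu : ((SpOneOne.polar A).2 : ℍ[ℝ]) = star (A.1 0 0 * (A.1 1 1)⁻¹) := by
    rw [SpOneOne.mul_inv_lower_right]; rfl
  have e : (A⁻¹ : SpOneOne).1 = signatureMatrix * A.1ᴴ * signatureMatrix := rfl
  have e00 : (A⁻¹ : SpOneOne).1 0 0 = star (A.1 0 0) := by
    rw [e]; simp [signatureMatrix, Matrix.mul_apply, Matrix.vecMul, dotProduct, Fin.sum_univ_two]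
  have e01 : (A⁻¹ : SpOneOne).1 0 1 = -star (A.1 1 0) := by
    rw [e]; simp [signatureMatrix, Matrix.mul_apply, Matrix.vecMul, dotProduct, Fin.sum_univ_two]
  have e10 : (A⁻¹ : SpOneOne).1 1 0 = -star (A.1 0 1) := by
    rw [e]; simp [signatureMatrix, Matrix.mul_apply, Matrix.vecMul, dotProduct, Fin.sum_univ_two]
  have e11 : (A⁻¹ : SpOneOne).1 1 1 = star (A.1 1 1) := by
    rw [e]; simp [signatureMatrix, Matrix.mul_apply, Matrix.vecMul, dotProduct, Fin.sum_univ_two]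
  rw [← regularQuotient_eq_mobiusParam hd', regularMobius, e00, e01, e10, e11]
  have f1 : ∀ x : ℍ[ℝ], star (A.1 1 1) * star (x * (A.1 1 1)⁻¹) = star x := by
    intro x
    rw [← star_mul, inv_mul_cancel_right₀ hd]
  -- The middle factor d⁻¹ conj (d⁻¹) is real and moves to the front; then b ā = d c̄ applies.
  have f2 : star (A.1 1 1) * (A.1 1 0 * (A.1 1 1)⁻¹ * star (A.1 0 0 * (A.1 1 1)⁻¹)) =
      star (A.1 0 1) := by
    have h1 : A.1 1 0 * star (A.1 0 0) = A.1 1 1 * star (A.1 0 1) := by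
      have := congrArg star (SpOneOne.rows A).1
      simpa only [star_mul, star_star] using this
    have h2 : (A.1 1 1)⁻¹ * star ((A.1 1 1)⁻¹) =
        (((Quaternion.normSq (A.1 1 1)⁻¹ : ℝ)) : ℍ[ℝ]) := Quaternion.self_mul_star _
    have h3 : star ((A.1 1 1)⁻¹) * (A.1 1 1)⁻¹ =
        (((Quaternion.normSq (A.1 1 1)⁻¹ : ℝ)) : ℍ[ℝ]) := Quaternion.star_mul_self _
    calc star (A.1 1 1) * (A.1 1 0 * (A.1 1 1)⁻¹ * star (A.1 0 0 * (A.1 1 1)⁻¹))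
        = star (A.1 1 1) * (A.1 1 0 * ((A.1 1 1)⁻¹ * star ((A.1 1 1)⁻¹)) * star (A.1 0 0)) := by
          simp only [star_mul, mul_assoc]
      _ = star (A.1 1 1) * (star ((A.1 1 1)⁻¹) * (A.1 1 1)⁻¹ *
            (A.1 1 0 * star (A.1 0 0))) := by
          rw [h2, h3, ← Quaternion.coe_commutes]; simp only [mul_assoc]
      _ = _ := by
          rw [h1, mul_assoc, inv_mul_cancel_left₀ hd, ← mul_assoc, ← star_mul, inv_mul_cancel₀ hd,
            star_one, one_mul]
  rw [ha, hu, f1, f2, f1]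

/-- The diffeomorphism from `Sp(1,1) / Sp(1) I₂` to `𝔹 × Sp(1)`. -/
def SpOneOne.ballDiffeomorph :
    (SpOneOne ⧸ spOneScalar) ≃ₘ⟮𝓡 7, 𝓘(ℝ, ℍ[ℝ]).prod (𝓡 3)⟯
      (unitBall × Metric.sphere (0 : ℍ[ℝ]) 1) :=
  SpOneOne.polarDiffeomorph.trans
    (unitBallDiffeomorph.symm.prodCongr (Diffeomorph.refl (𝓡 3) _ ∞))

theorem regularMobius_inv_eq (A : SpOneOne) :
    regularMobius (A⁻¹ : SpOneOne).1 =
      mobiusParam (SpOneOne.ballDiffeomorph (SpOneOne.proj A)).1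
        (SpOneOne.ballDiffeomorph (SpOneOne.proj A)).2 := by
  rw [regularMobius_inv, ← SpOneOne.polarDiffeomorph_proj]
  rfl

/-- The bijection `A Sp(1) I₂ ↦ 𝓕_{A⁻¹}` from `Sp(1,1) / Sp(1) I₂` to `𝓜(𝔹)`. -/
def RegularMobius.quotientEquiv : (SpOneOne ⧸ spOneScalar) ≃ RegularMobius :=
  Equiv.ofBijective
    (fun x => ⟨mobiusParam (SpOneOne.ballDiffeomorph x).1 (SpOneOne.ballDiffeomorph x).2, by
      obtain ⟨A, rfl⟩ := QuotientGroup.mk_surjective x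
      exact ⟨A⁻¹, (regularMobius_inv_eq A).symm⟩⟩) (by
    refine ⟨fun x y hxy => ?_, fun f => ?_⟩
    · obtain ⟨h1, h2⟩ := mobiusParam_injective
        (norm_eq_of_mem_sphere (SpOneOne.ballDiffeomorph x).2)
        (norm_eq_of_mem_sphere (SpOneOne.ballDiffeomorph y).2) (congrArg Subtype.val hxy)
      exact SpOneOne.ballDiffeomorph.injective (Prod.ext h1 (Subtype.ext h2))
    · obtain ⟨f, A, rfl⟩ := f
      refine ⟨SpOneOne.proj A⁻¹, Subtype.ext ?_⟩
      have h := (regularMobius_inv_eq A⁻¹).symm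
      rwa [inv_inv] at h)

theorem RegularMobius.quotientEquiv_proj (A : SpOneOne) :
    (RegularMobius.quotientEquiv (SpOneOne.proj A)).1 = regularMobius (A⁻¹ : SpOneOne).1 :=
  (regularMobius_inv_eq A).symm

/-- The topology and the charts are those of the quotient, carried along the bijection. -/
theorem exists_isInducedStructure :
    ∃ (τ : TopologicalSpace RegularMobius)
      (_ : ChartedSpace (EuclideanSpace ℝ (Fin 7)) RegularMobius), IsInducedStructure := by
  let τ : TopologicalSpace RegularMobius :=
    TopologicalSpace.induced RegularMobius.quotientEquiv.symm inferInstance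
  let f : (SpOneOne ⧸ spOneScalar) ≃ₜ RegularMobius :=
    (RegularMobius.quotientEquiv.symm.toHomeomorphOfIsInducing ⟨rfl⟩).symm
  exact ⟨τ, transportChartedSpace _ f, transport_isManifold f, transportDiffeomorph f,
    RegularMobius.quotientEquiv_proj⟩

/-- The linear isometry from `ℍ` to `ℝ⁴` as a diffeomorphism of the unit spheres. -/
def unitSphereDiffeomorph :
    Metric.sphere (0 : ℍ[ℝ]) 1 ≃ₘ⟮𝓡 3, 𝓡 3⟯
      Metric.sphere (0 : EuclideanSpace ℝ (Fin 4)) 1 where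
  toFun u := ⟨Quaternion.linearIsometryEquivTuple (u : ℍ[ℝ]), by
    rw [mem_sphere_zero_iff_norm, LinearIsometryEquiv.norm_map]; exact norm_eq_of_mem_sphere u⟩
  invFun v := ⟨Quaternion.linearIsometryEquivTuple.symm (v : EuclideanSpace ℝ (Fin 4)), by
    rw [mem_sphere_zero_iff_norm, LinearIsometryEquiv.norm_map]; exact norm_eq_of_mem_sphere v⟩
  left_inv u := Subtype.ext (Quaternion.linearIsometryEquivTuple.symm_apply_apply _)
  right_inv v := Subtype.ext (Quaternion.linearIsometryEquivTuple.apply_symm_apply _)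
  contMDiff_toFun := by
    have : Fact (Module.finrank ℝ (EuclideanSpace ℝ (Fin 4)) = 3 + 1) :=
      ⟨finrank_euclideanSpace_fin⟩
    exact ContMDiff.codRestrict_sphere
      (Quaternion.linearIsometryEquivTuple.contDiff.contMDiff.comp contMDiff_coe_sphere) _
  contMDiff_invFun := by
    have : Fact (Module.finrank ℝ (EuclideanSpace ℝ (Fin 4)) = 3 + 1) :=
      ⟨finrank_euclideanSpace_fin⟩
    exact ContMDiff.codRestrict_sphere
      (Quaternion.linearIsometryEquivTuple.symm.contDiff.contMDiff.comp contMDiff_coe_sphere) _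

/-- The diffeomorphism from `Sp(1,1) / Sp(1) I₂` to `ℝ⁴ × S³`. -/
def SpOneOne.euclideanDiffeomorph :
    (SpOneOne ⧸ spOneScalar) ≃ₘ⟮𝓡 7, (𝓡 4).prod (𝓡 3)⟯
      (EuclideanSpace ℝ (Fin 4) × Metric.sphere (0 : EuclideanSpace ℝ (Fin 4)) 1) :=
  SpOneOne.polarDiffeomorph.trans
    (Quaternion.linearIsometryEquivTuple.toContinuousLinearEquiv.toDiffeomorph.prodCongr
      unitSphereDiffeomorph)

end

theorem mainTheorem1 :
    -- the projection `Sp(1,1) → Sp(1,1) / Sp(1) I₂` is a submersion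
    (ContMDiff (𝓡 10) (𝓡 7) ∞ SpOneOne.proj ∧
      ∀ A : SpOneOne, Function.Surjective (mfderiv (𝓡 10) (𝓡 7) SpOneOne.proj A)) ∧
    -- the induced manifold structure on `𝓜(𝔹)` exists
    (∃ (τ : TopologicalSpace RegularMobius)
      (_ : ChartedSpace (EuclideanSpace ℝ (Fin 7)) RegularMobius), IsInducedStructure) ∧
    -- and for it `φ` is a diffeomorphism, so that `𝓜(𝔹)` is diffeomorphic to `ℝ⁴ × S³`
    ∀ (τ : TopologicalSpace RegularMobius)
      (_ : ChartedSpace (EuclideanSpace ℝ (Fin 7)) RegularMobius), IsInducedStructure →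
      (∃ Φ : (unitBall × Metric.sphere (0 : ℍ[ℝ]) 1) ≃ₘ⟮𝓘(ℝ, ℍ[ℝ]).prod (𝓡 3), 𝓡 7⟯ RegularMobius,
        ∀ (a : unitBall) (u : Metric.sphere (0 : ℍ[ℝ]) 1), (Φ (a, u)).1 = mobiusParam a u) ∧
      Nonempty (RegularMobius ≃ₘ⟮𝓡 7, (𝓡 4).prod (𝓡 3)⟯
        (EuclideanSpace ℝ (Fin 4) × Metric.sphere (0 : EuclideanSpace ℝ (Fin 4)) 1)) := by
  refine ⟨⟨SpOneOne.contMDiff_proj, SpOneOne.surjective_mfderiv_proj⟩,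
    exists_isInducedStructure, ?_⟩
  -- The structure is arbitrary, so Ψ is known only through its values on cosets; as every point of
  -- 𝔹 × Sp(1) comes from some coset, these values identify Φ with φ.
  rintro _ _ ⟨-, Ψ, hΨ⟩
  refine ⟨⟨SpOneOne.ballDiffeomorph.symm.trans Ψ, fun a u => ?_⟩,
    ⟨Ψ.symm.trans SpOneOne.euclideanDiffeomorph⟩⟩
  obtain ⟨A, hA⟩ := QuotientGroup.mk_surjective (SpOneOne.ballDiffeomorph.symm (a, u))
  have h := (hΨ A).trans (regularMobius_inv_eq A)
  have hA' : SpOneOne.proj A = SpOneOne.ballDiffeomorph.symm (a, u) := hA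
  rw [hA', Diffeomorph.apply_symm_apply] at h
  exact h
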